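/- Let $A$ and $B$ be (not necessarily unital) $C^*$-algebras and let $\varphi\colon A\to B$ be a bounded linear map. Regard the biduals $A^{**}$ and $B^{**}$ as $*$-algebras with the Arens product and the canonical involution (so that they are the enveloping von Neumann algebras of $A$ and $B$, with $A\subseteq A^{**}$ and $B\subseteq B^{**}$ via the canonical embeddings), let $1$ be the unit of $A^{**}$, and let $\varphi^{**}\colon A^{**}\to B^{**}$ be the bitranspose of $\varphi$. The following are equivalent. 1. $\varphi$ is a weighted $*$-homomorphism: there are a $C^*$-algebra $D$ containing $B$ as a $C^*$-subalgebra, a $*$-homomorphism $\pi\colon A\to D$ and an element $h\in D$ such that $\varphi(a)=h\pi(a)=\pi(a)h$ for all $a\in A$. 2. There is a $*$-homomorphism $\pi_\varphi\colon A\to B^{**}$ such that $\varphi(a)=\varphi^{**}(1)\pi_\varphi(a)=\pi_\varphi(a)\varphi^{**}(1)$ for all $a\in A$. 3. $\varphi$ preserves range-orthogonality ($a^*b=0$ implies $\varphi(a)^*\varphi(b)=0$), domain-orthogonality ($ab^*=0$ implies $\varphi(a)\varphi(b)^*=0$) and zero-products ($ab=0$ implies $\varphi(a)\varphi(b)=0$).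 Moreover, if these conditions hold, then $\pi_\varphi$ in (2) can be chosen canonically: there is exactly one $*$-homomorphism $\pi_\varphi\colon A\to B^{**}$ such that, for all $a,b\in A$, $\pi_\varphi(a)\varphi(b)=\varphi(ab)$ and $\pi_\varphi(a)\varphi(b)^*=\varphi(ba^*)^*$, and such that $\pi_\varphi(a)x=0$ whenever $a\in A$ and $x\in B^{**}$ satisfies $\varphi(b)x=0=\varphi(b)^*x$ for all $b\in A$; and this $\pi_\varphi$ satisfies the identities in (2). -/

import Mathlib

universe u v w

noncomputable section

namespace CStarBidual

open ContinuousLinearMap NormedSpace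

/-- The bidual `A**` of a C⋆-algebra: the Banach space double dual. It is equipped below with the
Arens product and the canonical involution, which make it the usual enveloping algebra `A**`. -/
abbrev Bidual (A : Type u) [NonUnitalCStarAlgebra A] : Type u :=
  StrongDual ℂ (StrongDual ℂ A)

section Structure

variable {A : Type u} [NonUnitalCStarAlgebra A]

/-- The module action of `A` on its dual: `(f · x) y = f (x * y)`. -/
def dualAct : StrongDual ℂ A →L[ℂ] A →L[ℂ] StrongDual ℂ A :=
  ((compL ℂ A (A →L[ℂ] A) (StrongDual ℂ A)).flip (mul ℂ A)) ∘L (compL ℂ A A ℂ)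

theorem dualAct_apply (f : StrongDual ℂ A) (x y : A) : dualAct f x y = f (x * y) := rfl

/-- The action of the bidual on the dual: `(G · f) x = G (f · x)`. -/
def bidualAct (G : Bidual A) : StrongDual ℂ A →L[ℂ] StrongDual ℂ A :=
  (compL ℂ A (StrongDual ℂ A) ℂ G) ∘L dualAct

theorem bidualAct_apply (G : Bidual A) (f : StrongDual ℂ A) (x : A) :
    bidualAct G f x = G (dualAct f x) := rfl

/-- The (first) Arens product on the bidual: `(F * G) f = F (G · f)`. -/
instance instMulBidual : Mul (Bidual A) := ⟨fun F G => F ∘L bidualAct G⟩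

theorem bidual_mul_apply (F G : Bidual A) (f : StrongDual ℂ A) :
    (F * G) f = F (bidualAct G f) := rfl

/-- With the Arens product the bidual is a ring, on its usual additive group. -/
instance instRingBidual : NonUnitalRing (Bidual A) :=
  { (inferInstance : AddCommGroup (Bidual A)), instMulBidual with
    left_distrib := fun F G H => by
      ext f
      have h : bidualAct (G + H) f = bidualAct G f + bidualAct H f := by ext x; rfl
      change F (bidualAct (G + H) f) = F (bidualAct G f) + F (bidualAct H f)
      rw [h, map_add]
    right_distrib := fun F G H => rfl
    zero_mul := fun F => rfl
    mul_zero := fun F => by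
      ext f
      have h : bidualAct (0 : Bidual A) f = 0 := by ext x; rfl
      change F (bidualAct (0 : Bidual A) f) = 0
      rw [h, map_zero]
    mul_assoc := fun F G H => by
      ext f
      change F (bidualAct G (bidualAct H f)) = F (bidualAct (G * H) f)
      congr 1
      ext x
      change G (dualAct (bidualAct H f) x) = G (bidualAct H (dualAct f x))
      congr 1
      ext y
      change H (dualAct f (x * y)) = H (dualAct (dualAct f x) y)
      congr 1
      ext z
      change f (x * y * z) = f (x * (y * z))
      rw [mul_assoc] }

/-- The adjoint functional `x ↦ conj (f (x*))`. -/
def dualStar (f : StrongDual ℂ A) : StrongDual ℂ A :=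
  LinearMap.mkContinuous
    { toFun := fun x => star (f (star x))
      map_add' := fun x y => by simp
      map_smul' := fun c x => by simp } ‖f‖
    (fun x => by simpa using f.le_opNorm (star x))

theorem dualStar_apply (f : StrongDual ℂ A) (x : A) : dualStar f x = star (f (star x)) := rfl

theorem norm_dualStar_le (f : StrongDual ℂ A) : ‖dualStar f‖ ≤ ‖f‖ :=
  LinearMap.mkContinuous_norm_le _ (norm_nonneg f) _

/-- The involution on the bidual: `F* f = conj (F (f*))`. -/
instance instStarBidual : Star (Bidual A) :=
  ⟨fun F => LinearMap.mkContinuous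
    { toFun := fun f => star (F (dualStar f))
      map_add' := fun f g => by
        have h : dualStar (f + g) = dualStar f + dualStar g := by
          ext x; simp [dualStar_apply]
        simp [h]
      map_smul' := fun c f => by
        have h : dualStar (c • f) = star c • dualStar f := by
          ext x; simp [dualStar_apply]
        simp [h] } ‖F‖
    (fun f => by
      have h1 := F.le_opNorm (dualStar f)
      have h2 := mul_le_mul_of_nonneg_left (norm_dualStar_le f) (norm_nonneg F)
      simpa using h1.trans h2)⟩

theorem bidual_star_apply (F : Bidual A) (f : StrongDual ℂ A) :
    (star F) f = star (F (dualStar f)) := rfl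

/-- `e` is the unit of `A**` (there is at most one two-sided identity). -/
def IsUnitElement (e : Bidual A) : Prop := ∀ F : Bidual A, e * F = F ∧ F * e = F

theorem IsUnitElement.unique {e e' : Bidual A} (h : IsUnitElement e) (h' : IsUnitElement e') :
    e = e' := by
  rw [← (h' e).2, (h e').1]

end Structure

section Maps

variable {A : Type u} {B : Type v} [NonUnitalCStarAlgebra A] [NonUnitalCStarAlgebra B]

/-- The bitranspose `φ** : A** → B**`, `φ** F = F ∘ φ*` with `φ* f = f ∘ φ`. -/
def bitranspose (φ : A →L[ℂ] B) : Bidual A →L[ℂ] Bidual B :=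
  (compL ℂ (StrongDual ℂ B) (StrongDual ℂ A) ℂ).flip ((compL ℂ A B ℂ).flip φ)

theorem bitranspose_apply (φ : A →L[ℂ] B) (F : Bidual A) (f : StrongDual ℂ B) :
    bitranspose φ F f = F (f ∘L φ) := rfl

/-- `φ` preserves zero-products. -/
def PreservesZeroProducts (φ : A →L[ℂ] B) : Prop :=
  ∀ a b : A, a * b = 0 → φ a * φ b = 0

/-- `φ` preserves range-orthogonality. -/
def PreservesRangeOrthogonality (φ : A →L[ℂ] B) : Prop :=
  ∀ a b : A, star a * b = 0 → star (φ a) * φ b = 0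

/-- `φ` preserves domain-orthogonality. -/
def PreservesDomainOrthogonality (φ : A →L[ℂ] B) : Prop :=
  ∀ a b : A, a * star b = 0 → φ a * star (φ b) = 0

/-- `φ` is a weighted ⋆-homomorphism: for some C⋆-algebra `D` containing `B` (through an injective
⋆-homomorphism `i`), some ⋆-homomorphism `π : A → D` and some `h ∈ D`, one has
`φ a = h * π a = π a * h`. -/
def IsWeightedStarHom (φ : A →L[ℂ] B) : Prop :=
  ∃ (D : Type (max v w)) (_ : NonUnitalCStarAlgebra D) (i : B →⋆ₙₐ[ℂ] D) (π : A →⋆ₙₐ[ℂ] D) (h : D),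
    Function.Injective i ∧ ∀ a : A, i (φ a) = h * π a ∧ i (φ a) = π a * h

/-- `φ a = h * π a = π a * h` in `B**`, for all `a`. -/
def IsWeightedBy (φ : A →L[ℂ] B) (h : Bidual B) (π : A →⋆ₙₐ[ℂ] Bidual B) : Prop :=
  ∀ a : A, inclusionInDoubleDual ℂ B (φ a) = h * π a ∧
    inclusionInDoubleDual ℂ B (φ a) = π a * h

/-- The requirements that single out the canonical support ⋆-homomorphism of `φ`:
`π a * φ b = φ (a * b)`, `π a * (φ b)* = (φ (b * a*))*`, and `π a` vanishes off the ranges of the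
`φ b` and `(φ b)*`, i.e. on whatever is annihilated by all `φ b` and `(φ b)*`. -/
structure IsSupportHom (φ : A →L[ℂ] B) (π : A →⋆ₙₐ[ℂ] Bidual B) : Prop where
  mul_map : ∀ a b : A,
    π a * inclusionInDoubleDual ℂ B (φ b) = inclusionInDoubleDual ℂ B (φ (a * b))
  mul_star_map : ∀ a b : A,
    π a * inclusionInDoubleDual ℂ B (star (φ b)) =
      inclusionInDoubleDual ℂ B (star (φ (b * star a)))
  mul_eq_zero : ∀ (a : A) (x : Bidual B),
    (∀ b : A, inclusionInDoubleDual ℂ B (φ b) * x = 0 ∧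
      inclusionInDoubleDual ℂ B (star (φ b)) * x = 0) → π a * x = 0

end Maps

end CStarBidual

end

/-! The substantial implication is 3 ⇒ 2. Let `X` and `Y` each be `φ` or its adjoint map `φ'`, where
`φ' a = (φ a*)*`. The three orthogonality conditions say precisely that `a b = 0` forces `X a * Y b
= 0`. A bounded bilinear map vanishing on zero-products is balanced
(`balanced_of_map_zero_product`), so `X (a c) * Y b = X a * Y (c b)`. With `h = φ**(1)` taken as
value at the unit, this extends to the unitization of `A` and becomes `X a * Y b = X 1 * Y (a b)`.

Put `T a = φ a * h* + φ' a * h` and `k = T 1 = h h* + h* h`. Then `T a * X b = k * X (a b)` and `T a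
* T b = k * T (a b)`, so formally `π a = T a * k⁻¹`. As `k` need not be invertible, `k⁻¹` is
replaced by the polynomials `g = t ∑_{j<n} (1 - t k)^j`, for which `k g = 1 - (1 - t k)^n`. The
inequality `(T a)* T a ≤ ‖a‖² k²` bounds `T a * g`, and `X b (X b)* ≤ ‖b‖² k` gives norm convergence
of `T a * g * X b` to `X (a b)`. A weak⋆ limit of `T a * g` along an ultrafilter is `π a`.
Multiplicativity and uniqueness both come from showing `z z* = 0` for the relevant difference `z`.

These estimates need a C⋆-algebra. Positive functionals span the dual, so the GNS representations
embed the bidual as a ⋆-algebra in some C⋆-algebra `D` (`exists_bidual_embedding`). The same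
embedding gives 2 ⇒ 1, while 1 ⇒ 3 is a direct computation. -/

noncomputable section

namespace CStarBidual

open ContinuousLinearMap NormedSpace Filter Topology
open scoped ComplexOrder

/-! ### Jordan decomposition of bounded functionals -/

section Jordan

variable {M : Type u} [NonUnitalCStarAlgebra M]

/-- The complex linear extension of a real functional on the selfadjoint part. -/
def complexExtend (g : selfAdjoint M →ₗ[ℝ] ℝ) : M →ₗ[ℂ] ℂ where
  toFun x := (g (realPart x) : ℂ) + Complex.I * g (imaginaryPart x)
  map_add' x y := by simp only [map_add, Complex.ofReal_add]; ring
  map_smul' c x := by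
    simp only [realPart_smul, imaginaryPart_smul, map_sub, map_add, map_smul, smul_eq_mul,
      Complex.ofReal_sub, Complex.ofReal_add, Complex.ofReal_mul, RingHom.id_apply]
    conv_rhs => rw [← Complex.re_add_im c]
    linear_combination (-(c.im : ℂ) * (g (imaginaryPart x))) * Complex.I_sq

theorem complexExtend_apply (g : selfAdjoint M →ₗ[ℝ] ℝ) (x : M) :
    complexExtend g x = (g (realPart x) : ℂ) + Complex.I * g (imaginaryPart x) := rfl

variable [PartialOrder M] [StarOrderedRing M]

/-- A bounded real functional on the selfadjoint part of a C⋆-algebra is dominated on positive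
elements by a positive functional. -/
theorem exists_nonneg_dominating (u : selfAdjoint M →ₗ[ℝ] ℝ) (K : ℝ) (hK : 0 ≤ K)
    (hu : ∀ x, |u x| ≤ K * ‖x‖) :
    ∃ g : selfAdjoint M →ₗ[ℝ] ℝ, ∀ x : selfAdjoint M, 0 ≤ (x : M) → 0 ≤ g x ∧ u x ≤ g x := by
  -- The infimum of `S` is the Hahn-Banach majorant. For `x ≥ 0`, a functional `g` below it has `g
  -- (-x) ≤ 0` (take `c = z = 0`) and `g (-x) ≤ -u x` (take `c = x`, `z = 0`).
  let S : selfAdjoint M → Set ℝ := fun x =>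
    {r | ∃ c z : selfAdjoint M, 0 ≤ (c : M) ∧ (x + c : M) ≤ z ∧ r = K * ‖z‖ - u c}
  have hne : ∀ x, (S x).Nonempty := fun x => ⟨_, 0, x, by simp, by simp, rfl⟩
  have hbdd : ∀ x, BddBelow (S x) := by
    refine fun x => ⟨-(K * ‖x‖), ?_⟩
    rintro _ ⟨c, z, hc, hcz, rfl⟩
    have h1 : ‖c‖ ≤ ‖z - x‖ := by
      have : (c : M) ≤ ((z - x : selfAdjoint M) : M) := by
        rw [AddSubgroupClass.coe_sub, le_sub_iff_add_le, add_comm]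
        exact hcz
      exact CStarAlgebra.norm_le_norm_of_nonneg_of_le hc this
    have h2 := norm_sub_le z x
    have h3 := (le_abs_self _).trans (hu c)
    nlinarith [mul_le_mul_of_nonneg_left (h1.trans h2) hK]
  let N : selfAdjoint M → ℝ := fun x => sInf (S x)
  have hN_le : ∀ x c z : selfAdjoint M, 0 ≤ (c : M) → (x + c : M) ≤ z → N x ≤ K * ‖z‖ - u c :=
    fun x c z hc hz => csInf_le (hbdd x) ⟨c, z, hc, hz, rfl⟩
  have hN_smul_le : ∀ t : ℝ, 0 < t → ∀ x, N (t • x) ≤ t * N x := by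
    intro t ht x
    rw [← div_le_iff₀' ht]
    refine le_csInf (hne x) ?_
    rintro _ ⟨c, z, hc, hz, rfl⟩
    rw [div_le_iff₀' ht]
    have h := hN_le (t • x) (t • c) (t • z) (by simpa using smul_nonneg ht.le hc)
      (by simpa [← smul_add] using smul_le_smul_of_nonneg_left hz ht.le)
    rw [norm_smul, Real.norm_of_nonneg ht.le, map_smul, smul_eq_mul] at h
    linarith
  have hN_smul : ∀ t : ℝ, 0 < t → ∀ x, N (t • x) = t * N x := by
    refine fun t ht x => le_antisymm (hN_smul_le t ht x) ?_
    have h := hN_smul_le t⁻¹ (inv_pos.mpr ht) (t • x)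
    rw [smul_smul, inv_mul_cancel₀ ht.ne', one_smul] at h
    rwa [← le_inv_mul_iff₀ ht]
  have hN_add : ∀ x y, N (x + y) ≤ N x + N y := by
    intro x y
    rw [← sub_le_iff_le_add]
    refine le_csInf (hne x) ?_
    rintro _ ⟨c, z, hc, hz, rfl⟩
    rw [sub_le_comm]
    refine le_csInf (hne y) ?_
    rintro _ ⟨c', z', hc', hz', rfl⟩
    have h := hN_le (x + y) (c + c') (z + z') (by simpa using add_nonneg hc hc')
      (by simpa [add_add_add_comm] using add_le_add hz hz')
    rw [map_add] at h
    linarith [mul_le_mul_of_nonneg_left (norm_add_le z z') hK]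
  obtain ⟨g, -, hg⟩ := exists_extension_of_le_sublinear (⊥ : selfAdjoint M →ₗ.[ℝ] ℝ) N hN_smul hN_add
    (by
      rintro ⟨x, hx⟩
      obtain rfl : x = 0 := (Submodule.mem_bot ℝ).mp hx
      have h0 : N 0 = 0 := by
        have := hN_smul 2 two_pos 0
        rw [smul_zero] at this
        linarith
      rw [h0]
      exact le_of_eq (LinearPMap.map_zero _))
  refine ⟨g, fun x hx => ⟨?_, ?_⟩⟩
  · have h := (hg (-x)).trans (hN_le (-x) 0 0 (by simp) (by simpa using hx))
    rw [map_neg] at h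
    simp only [norm_zero, mul_zero, map_zero, sub_zero] at h
    linarith
  · have h := (hg (-x)).trans (hN_le (-x) x 0 hx (by simp))
    rw [map_neg] at h
    simp only [norm_zero, mul_zero, zero_sub] at h
    linarith

theorem complexExtend_nonneg (g : selfAdjoint M →ₗ[ℝ] ℝ)
    (hg : ∀ x : selfAdjoint M, 0 ≤ (x : M) → 0 ≤ g x) (x : M) (hx : 0 ≤ x) :
    0 ≤ complexExtend g x := by
  have hs : IsSelfAdjoint x := IsSelfAdjoint.of_nonneg hx
  rw [complexExtend_apply, hs.imaginaryPart]
  have : 0 ≤ g (realPart x) := hg _ (by rwa [hs.coe_realPart])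
  simpa using this

/-- Every bounded functional on a C⋆-algebra is a linear combination of four positive ones. -/
theorem exists_positive_decomposition (f : StrongDual ℂ M) :
    ∃ g : Fin 4 → (M →ₚ[ℂ] ℂ), ∀ x,
      f x = g 0 x - g 1 x + Complex.I * (g 2 x - g 3 x) := by
  -- If `g` dominates `u`, then `u = g - (g - u)` is a difference of positive functionals. This is
  -- used for the real and the imaginary part of `f` on selfadjoint elements.
  have key : ∀ u : selfAdjoint M →ₗ[ℝ] ℝ, (∀ x, |u x| ≤ ‖f‖ * ‖x‖) →
      ∃ g g' : M →ₚ[ℂ] ℂ, ∀ x, complexExtend u x = g x - g' x := by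
    intro u hu
    obtain ⟨g, hg⟩ := exists_nonneg_dominating u _ (norm_nonneg f) hu
    refine ⟨.mk₀ (complexExtend g) (complexExtend_nonneg g fun x hx => (hg x hx).1),
      .mk₀ (complexExtend (g - u)) (complexExtend_nonneg _ fun x hx => ?_), fun x => ?_⟩
    · simpa using (hg x hx).2
    · change _ = complexExtend g x - complexExtend (g - u) x
      simp only [complexExtend_apply, LinearMap.sub_apply, Complex.ofReal_sub]
      ring
  let ι : selfAdjoint M →ₗ[ℝ] M := (selfAdjoint.submodule ℝ M).subtype
  obtain ⟨g, g', h⟩ := key (Complex.reLm ∘ₗ (f : M →ₗ[ℂ] ℂ).restrictScalars ℝ ∘ₗ ι) fun x =>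
    (Complex.abs_re_le_norm _).trans (f.le_opNorm x)
  obtain ⟨p, p', h'⟩ := key (Complex.imLm ∘ₗ (f : M →ₗ[ℂ] ℂ).restrictScalars ℝ ∘ₗ ι) fun x =>
    (Complex.abs_im_le_norm _).trans (f.le_opNorm x)
  refine ⟨![g, g', p, p'], fun x => ?_⟩
  simp only [Matrix.cons_val]
  rw [← h, ← h']
  change _ = ((f (realPart x : M)).re : ℂ) + Complex.I * ((f (imaginaryPart x : M)).re : ℂ) +
    Complex.I * (((f (realPart x : M)).im : ℂ) + Complex.I * ((f (imaginaryPart x : M)).im : ℂ))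
  conv_lhs => rw [← realPart_add_I_smul_imaginaryPart x, map_add, map_smul, smul_eq_mul,
    ← Complex.re_add_im (f (realPart x : M)), ← Complex.re_add_im (f (imaginaryPart x : M))]
  ring

end Jordan

/-! ### Extending a representation to the bidual -/

section Representation

variable {B : Type v} [NonUnitalCStarAlgebra B] {H : Type*} [NormedAddCommGroup H]
  [InnerProductSpace ℂ H] [CompleteSpace H]

/-- The vector functional `b ↦ ⟪ξ, ρ b η⟫` of a representation. -/
def vectorFunctional (ρ : B →⋆ₙₐ[ℂ] (H →L[ℂ] H)) (ξ η : H) : StrongDual ℂ B :=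
  LinearMap.mkContinuous
    { toFun := fun b => inner ℂ ξ (ρ b η)
      map_add' := fun x y => by simp
      map_smul' := fun c x => by simp } (‖ξ‖ * ‖η‖)
    (fun b => by
      have h1 : ‖ρ b‖ ≤ ‖b‖ := NonUnitalStarAlgHom.norm_apply_le ρ b
      have h2 : ‖ρ b η‖ ≤ ‖b‖ * ‖η‖ := (ρ b).le_of_opNorm_le h1 η
      calc ‖inner ℂ ξ (ρ b η)‖ ≤ ‖ξ‖ * ‖ρ b η‖ := norm_inner_le_norm _ _
        _ ≤ ‖ξ‖ * (‖b‖ * ‖η‖) := by gcongr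
        _ = _ := by ring)

theorem vectorFunctional_apply (ρ : B →⋆ₙₐ[ℂ] (H →L[ℂ] H)) (ξ η : H) (b : B) :
    vectorFunctional ρ ξ η b = inner ℂ ξ (ρ b η) := rfl

theorem norm_vectorFunctional_le (ρ : B →⋆ₙₐ[ℂ] (H →L[ℂ] H)) (ξ η : H) :
    ‖vectorFunctional ρ ξ η‖ ≤ ‖ξ‖ * ‖η‖ :=
  LinearMap.mkContinuous_norm_le _ (by positivity) _

theorem norm_apply_vectorFunctional_le (ρ : B →⋆ₙₐ[ℂ] (H →L[ℂ] H)) (F : Bidual B) (ξ η : H) :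
    ‖F (vectorFunctional ρ ξ η)‖ ≤ ‖F‖ * ‖ξ‖ * ‖η‖ := by
  rw [mul_assoc]
  exact F.le_opNorm_of_le (norm_vectorFunctional_le ρ ξ η)

/-- The sesquilinear form `(ξ, η) ↦ F ⟪ξ, ρ · η⟫`. -/
def bidualForm (ρ : B →⋆ₙₐ[ℂ] (H →L[ℂ] H)) (F : Bidual B) : H →L⋆[ℂ] H →L[ℂ] ℂ :=
  LinearMap.mkContinuous₂
    (LinearMap.mk₂'ₛₗ (starRingEnd ℂ) (RingHom.id ℂ) (fun ξ η => F (vectorFunctional ρ ξ η))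
      (fun ξ ξ' η => by
        rw [← map_add]; congr 1; ext b; simp [vectorFunctional_apply])
      (fun c ξ η => by
        rw [← map_smul]; congr 1; ext b
        simp [vectorFunctional_apply, mul_comm])
      (fun ξ η η' => by
        rw [← map_add]; congr 1; ext b; simp [vectorFunctional_apply])
      (fun c ξ η => by
        rw [RingHom.id_apply, ← map_smul]; congr 1; ext b
        simp [vectorFunctional_apply]))
    ‖F‖ (norm_apply_vectorFunctional_le ρ F)

/-- The extension of a representation of `B` to the bidual of `B`. -/
def bidualExtend (ρ : B →⋆ₙₐ[ℂ] (H →L[ℂ] H)) (F : Bidual B) : H →L[ℂ] H :=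
  adjoint (InnerProductSpace.continuousLinearMapOfBilin (bidualForm ρ F))

theorem inner_bidualExtend (ρ : B →⋆ₙₐ[ℂ] (H →L[ℂ] H)) (F : Bidual B) (ξ η : H) :
    inner ℂ ξ (bidualExtend ρ F η) = F (vectorFunctional ρ ξ η) := by
  rw [bidualExtend, adjoint_inner_right, InnerProductSpace.continuousLinearMapOfBilin_apply]
  rfl

theorem norm_bidualExtend_le (ρ : B →⋆ₙₐ[ℂ] (H →L[ℂ] H)) (F : Bidual B) :
    ‖bidualExtend ρ F‖ ≤ ‖F‖ :=
  ContinuousLinearMap.opNorm_le_bound _ (norm_nonneg F) fun η => by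
    rcases eq_or_ne (bidualExtend ρ F η) 0 with h | h
    · rw [h, norm_zero]; positivity
    · have h1 := norm_apply_vectorFunctional_le ρ F (bidualExtend ρ F η) η
      rw [← inner_bidualExtend, inner_self_eq_norm_sq_to_K, norm_pow, RCLike.norm_ofReal,
        abs_norm] at h1
      have h2 : 0 < ‖bidualExtend ρ F η‖ := norm_pos_iff.mpr h
      nlinarith

theorem bidualExtend_add (ρ : B →⋆ₙₐ[ℂ] (H →L[ℂ] H)) (F G : Bidual B) :
    bidualExtend ρ (F + G) = bidualExtend ρ F + bidualExtend ρ G := by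
  ext η
  refine ext_inner_left ℂ fun ξ => ?_
  simp [inner_bidualExtend, inner_add_right]

theorem bidualExtend_smul (ρ : B →⋆ₙₐ[ℂ] (H →L[ℂ] H)) (c : ℂ) (F : Bidual B) :
    bidualExtend ρ (c • F) = c • bidualExtend ρ F := by
  ext η
  refine ext_inner_left ℂ fun ξ => ?_
  simp [inner_bidualExtend, inner_smul_right]

/-- The Arens action of `G` turns the vector functional of `(ξ, η)` into that of `(ξ, bidualExtend ρ
G η)`. -/
theorem bidualExtend_mul (ρ : B →⋆ₙₐ[ℂ] (H →L[ℂ] H)) (F G : Bidual B) :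
    bidualExtend ρ (F * G) = bidualExtend ρ F * bidualExtend ρ G := by
  ext η
  refine ext_inner_left ℂ fun ξ => ?_
  rw [mul_apply_eq_comp, inner_bidualExtend, inner_bidualExtend, bidual_mul_apply]
  congr 1
  ext x
  rw [bidualAct_apply, vectorFunctional_apply, ← adjoint_inner_left, inner_bidualExtend]
  congr 1
  ext y
  rw [dualAct_apply, vectorFunctional_apply, vectorFunctional_apply, map_mul, mul_apply_eq_comp,
    adjoint_inner_left]

theorem bidualExtend_star (ρ : B →⋆ₙₐ[ℂ] (H →L[ℂ] H)) (F : Bidual B) :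
    bidualExtend ρ (star F) = star (bidualExtend ρ F) := by
  ext η
  refine ext_inner_left ℂ fun ξ => ?_
  rw [star_eq_adjoint, adjoint_inner_right, inner_bidualExtend, bidual_star_apply,
    ← inner_conj_symm, inner_bidualExtend]
  change star _ = star _
  congr 2
  ext b
  rw [dualStar_apply, vectorFunctional_apply, vectorFunctional_apply, map_star, star_eq_adjoint,
    adjoint_inner_right]
  exact inner_conj_symm _ _

end Representation

/-! ### Cyclic vectors of GNS representations -/

section GNS

variable {M : Type u} [CStarAlgebra M] [PartialOrder M] [StarOrderedRing M]

/-- A positive functional on a unital C⋆-algebra is the vector functional of the cyclic vector of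
its Gelfand-Naimark-Segal representation. -/
theorem exists_gns_vector (f : M →ₚ[ℂ] ℂ) :
    ∃ ξ : f.GNS, ∀ x, inner ℂ ξ (f.gnsNonUnitalStarAlgHom x ξ) = f x := by
  refine ⟨((f.toPreGNS 1 : f.PreGNS) : f.GNS), fun x => ?_⟩
  rw [f.gnsNonUnitalStarAlgHom_apply_coe, UniformSpace.Completion.inner_coe,
    f.preGNS_inner_def]
  simp

end GNS

/-! ### Embedding the bidual in a C⋆-algebra -/

section Embedding

open scoped ENNReal

variable {B : Type v} [NonUnitalCStarAlgebra B]

/-- If the vector functionals of a family of representations span the dual, then the bidual embeds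
as a ⋆-algebra into the bounded families of operators. -/
theorem exists_bidual_embedding_of_span {ι : Type w} {H : ι → Type u}
    [∀ i, NormedAddCommGroup (H i)] [∀ i, InnerProductSpace ℂ (H i)] [∀ i, CompleteSpace (H i)]
    (ρ : ∀ i, B →⋆ₙₐ[ℂ] (H i →L[ℂ] H i))
    (hρ : ∀ f, f ∈ Submodule.span ℂ {f | ∃ i ξ η, f = vectorFunctional (ρ i) ξ η}) :
    ∃ (D : Type (max u w)) (_ : NonUnitalCStarAlgebra D) (Φ : Bidual B →ₗ[ℂ] D),
      (∀ F G, Φ (F * G) = Φ F * Φ G) ∧ (∀ F, Φ (star F) = star (Φ F)) ∧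
        ∀ f, ∃ C : ℝ, ∀ F, ‖F f‖ ≤ C * ‖Φ F‖ := by
  have hmem : ∀ F : Bidual B, Memℓp (fun i => bidualExtend (ρ i) F) ∞ := fun F =>
    memℓp_infty ⟨‖F‖, by rintro _ ⟨i, rfl⟩; exact norm_bidualExtend_le _ F⟩
  let Ψ : Bidual B →ₗ[ℂ] lp (fun i => H i →L[ℂ] H i) ∞ :=
    { toFun := fun F => ⟨fun i => bidualExtend (ρ i) F, hmem F⟩
      map_add' := fun F G => Subtype.ext <| funext fun i => bidualExtend_add _ F G
      map_smul' := fun c F => Subtype.ext <| funext fun i => bidualExtend_smul _ c F }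
  refine ⟨lp (fun i => H i →L[ℂ] H i) ∞, inferInstance, Ψ,
    fun F G => Subtype.ext <| funext fun i => bidualExtend_mul _ F G,
    fun F => Subtype.ext <| funext fun i => bidualExtend_star _ F, fun f => ?_⟩
  · induction hρ f using Submodule.span_induction with
    | mem f hf =>
      obtain ⟨i, ξ, η, rfl⟩ := hf
      refine ⟨‖ξ‖ * ‖η‖, fun F => ?_⟩
      have h1 : ‖bidualExtend (ρ i) F‖ ≤ ‖Ψ F‖ :=
        lp.norm_apply_le_norm ENNReal.top_ne_zero (Ψ F) i
      rw [← inner_bidualExtend]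
      calc _ ≤ ‖ξ‖ * ‖bidualExtend (ρ i) F η‖ := norm_inner_le_norm _ _
        _ ≤ ‖ξ‖ * (‖Ψ F‖ * ‖η‖) := by
          gcongr
          exact ContinuousLinearMap.le_of_opNorm_le _ h1 η
        _ = _ := by ring
    | zero => exact ⟨0, fun F => by simp⟩
    | add f g _ _ hf hg =>
      obtain ⟨C, hC⟩ := hf
      obtain ⟨C', hC'⟩ := hg
      refine ⟨C + C', fun F => ?_⟩
      rw [map_add, add_mul]
      exact norm_add_le_of_le (hC F) (hC' F)
    | smul c f _ hf =>
      obtain ⟨C, hC⟩ := hf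
      refine ⟨‖c‖ * C, fun F => ?_⟩
      rw [map_smul, norm_smul, mul_assoc]
      exact mul_le_mul_of_nonneg_left (hC F) (norm_nonneg c)

variable (B)

/-- The bidual embeds as a ⋆-algebra into a C⋆-algebra, in such a way that the functionals in the
predual are controlled by the norm. -/
theorem exists_bidual_embedding :
    ∃ (D : Type (max v w)) (_ : CStarAlgebra D) (Φ : Bidual B →ₗ[ℂ] D),
      (∀ F G, Φ (F * G) = Φ F * Φ G) ∧ (∀ F, Φ (star F) = star (Φ F)) ∧
        ∀ f, ∃ C : ℝ, ∀ F, ‖F f‖ ≤ C * ‖Φ F‖ := by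
  let _ : PartialOrder (Unitization ℂ B) := CStarAlgebra.spectralOrder _
  have _ : StarOrderedRing (Unitization ℂ B) := CStarAlgebra.spectralOrderedRing _
  -- The `ULift` only raises the universe, so that `D` can live in any `Type (max v w)`.
  let S : Set (StrongDual ℂ B) := {f | ∃ (i : ULift.{w} (Unitization ℂ B →ₚ[ℂ] ℂ))
    (ξ η : i.down.GNS), f = vectorFunctional (i.down.gnsNonUnitalStarAlgHom.comp
      (Unitization.inrNonUnitalStarAlgHom ℂ B)) ξ η}
  have hspan : ∀ f : StrongDual ℂ B, f ∈ Submodule.span ℂ S := by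
    intro f
    obtain ⟨g, hg⟩ := exists_positive_decomposition
      (f ∘L ⟨Unitization.sndHom ℂ ℂ B, Unitization.continuous_snd⟩)
    choose ξ hξ using fun i => exists_gns_vector (g i)
    let l : Fin 4 → StrongDual ℂ B := fun i => vectorFunctional
      ((g i).gnsNonUnitalStarAlgHom.comp (Unitization.inrNonUnitalStarAlgHom ℂ B)) (ξ i) (ξ i)
    have hlg : ∀ i b, l i b = g i b := fun i b => hξ i b
    have hf : f = l 0 - l 1 + Complex.I • (l 2 - l 3) := by
      ext b
      have h := hg b
      change f b = _ at h
      simpa [hlg] using h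
    have hl := fun i => Submodule.subset_span (R := ℂ) (show l i ∈ S from
      ⟨⟨g i⟩, ξ i, ξ i, rfl⟩)
    rw [hf]
    exact add_mem (sub_mem (hl 0) (hl 1)) (Submodule.smul_mem _ _ (sub_mem (hl 2) (hl 3)))
  obtain ⟨D, _, Φ, hmul, hstar, hnorm⟩ := exists_bidual_embedding_of_span.{v, v, max v w} _ hspan
  -- Unitizing supplies the unit that expressions such as `1 - t k` need; `Φ` is not claimed to be
  -- unital.
  refine ⟨Unitization ℂ D, inferInstance, Unitization.inrHom ℂ ℂ D ∘ₗ Φ, fun F G => ?_,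
    fun F => ?_, fun f => ?_⟩
  · change Unitization.inr (Φ (F * G)) = Unitization.inr (Φ F) * Unitization.inr (Φ G)
    rw [hmul, Unitization.inr_mul]
  · change Unitization.inr (Φ (star F)) = star (Unitization.inr (Φ F))
    rw [hstar, Unitization.inr_star]
  · obtain ⟨C, hC⟩ := hnorm f
    refine ⟨C, fun F => ?_⟩
    change _ ≤ C * ‖(Unitization.inr (Φ F) : Unitization ℂ D)‖
    rw [Unitization.norm_inr]
    exact hC F

end Embedding

/-! ### Bilinear maps vanishing on zero-products -/

section ZeroProduct

variable {K : Type*} [TopologicalSpace K]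

/-- The continuous function `x ↦ n s(x) + 1 - i`, truncated to `[0, 1]`. -/
def ramp (s : C(K, ℝ)) (n i : ℕ) : C(K, ℝ) :=
  ⟨fun x => max 0 (min 1 (n * s x + 1 - i)), by fun_prop⟩

theorem ramp_apply (s : C(K, ℝ)) (n i : ℕ) (x : K) :
    ramp s n i x = max 0 (min 1 (n * s x + 1 - i)) := rfl

theorem ramp_mem (s : C(K, ℝ)) (n i : ℕ) (x : K) : 0 ≤ ramp s n i x ∧ ramp s n i x ≤ 1 := by
  rw [ramp_apply]
  exact ⟨le_max_left _ _, max_le zero_le_one (min_le_left _ _)⟩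

/-- Before truncation the two functions differ by `j - i ≥ 1`, the length of the interval of
truncation. -/
theorem ramp_eq_zero_or_eq_one (s : C(K, ℝ)) (n : ℕ) {i j : ℕ} (hij : i < j) (x : K) :
    ramp s n j x = 0 ∨ ramp s n i x = 1 := by
  have h : (i : ℝ) + 1 ≤ j := by exact_mod_cast hij
  simp only [ramp_apply]
  rcases le_total (n * s x + 1 - (j : ℝ)) 0 with h0 | h0
  · left
    rw [min_eq_right (by linarith), max_eq_left h0]
  · right
    rw [min_eq_left (by linarith), max_eq_right zero_le_one]

theorem ramp_antitone (s : C(K, ℝ)) (n i : ℕ) (x : K) : ramp s n (i + 1) x ≤ ramp s n i x := by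
  simp only [ramp_apply, Nat.cast_add, Nat.cast_one]
  gcongr
  linarith

/-- The tent functions associated with `ramp`. -/
def tent (s : C(K, ℝ)) (n i : ℕ) : C(K, ℝ) := ramp s n i - ramp s n (i + 1)

theorem ramp_succ_mul_one_sub_ramp (s : C(K, ℝ)) (n i : ℕ) :
    ramp s n (i + 1) * (1 - ramp s n i) = 0 := by
  ext x
  rcases ramp_eq_zero_or_eq_one s n (Nat.lt_succ_self i) x with h | h <;> simp [h]

/-- For `s ≥ 0` the `i`-th tent lives where `i - 1 < n s < i + 1`, so only neighbouring tents
overlap. -/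
theorem tent_mul_tent (s : C(K, ℝ)) (n : ℕ) {i j : ℕ} (hij : i + 2 ≤ j ∨ j + 2 ≤ i) :
    tent s n i * tent s n j = 0 := by
  wlog h : i + 2 ≤ j generalizing i j
  · rw [mul_comm]
    exact this hij.symm (hij.resolve_left h)
  ext x
  rcases ramp_eq_zero_or_eq_one s n (show i + 1 < j by lia) x with h | h
  · have h' : ramp s n (j + 1) x = 0 :=
      le_antisymm ((ramp_antitone s n j x).trans h.le) (ramp_mem s n _ x).1
    simp [tent, h, h']
  · have h' : ramp s n i x = 1 :=
      le_antisymm (ramp_mem s n _ x).2 (h.ge.trans (ramp_antitone s n i x))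
    simp [tent, h, h']

theorem norm_sum_tent_le [CompactSpace K] (s : C(K, ℝ)) (n : ℕ) (t : Finset ℕ) :
    ‖∑ i ∈ t, tent s n i‖ ≤ 1 := by
  rw [ContinuousMap.norm_le _ zero_le_one]
  intro x
  have h0 : ∀ i, 0 ≤ tent s n i x := fun i => sub_nonneg.mpr (ramp_antitone s n i x)
  rw [ContinuousMap.sum_apply, Real.norm_of_nonneg (Finset.sum_nonneg fun i _ => h0 i)]
  obtain ⟨N, hN⟩ := t.exists_nat_subset_range
  calc _ ≤ ∑ i ∈ Finset.range N, tent s n i x :=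
        Finset.sum_le_sum_of_subset_of_nonneg hN fun i _ _ => h0 i
    _ = ramp s n 0 x - ramp s n N x := Finset.sum_range_sub' (fun i => ramp s n i x) N
    _ ≤ 1 := by linarith [(ramp_mem s n 0 x).2, (ramp_mem s n N x).1]

/-- Truncating `n s - i` to `[0, 1]` is a difference of consecutive positive parts `max 0 (n s -
i)`, so the sum telescopes. -/
theorem sum_ramp (s : C(K, ℝ)) (hs : ∀ x, 0 ≤ s x ∧ s x ≤ 1) (n : ℕ) :
    ∑ i ∈ Finset.range n, ramp s n (i + 1) = (n : ℝ) • s := by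
  ext x
  have h : ∀ i : ℕ, ramp s n (i + 1) x =
      max 0 (n * s x - i) - max 0 (n * s x - ((i + 1 : ℕ) : ℝ)) := by
    intro i
    rw [ramp_apply]
    push_cast
    rcases max_cases (0 : ℝ) (n * s x - i) with h1 | h1 <;>
    rcases max_cases (0 : ℝ) (n * s x - (i + 1)) with h2 | h2 <;>
    rcases min_cases (1 : ℝ) (n * s x + 1 - (i + 1)) with h3 | h3 <;>
    rcases max_cases (0 : ℝ) (min 1 (n * s x + 1 - (i + 1))) with h4 | h4 <;>
    linarith
  rw [ContinuousMap.sum_apply, Finset.sum_congr rfl fun i _ => h i,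
    Finset.sum_range_sub' (fun i : ℕ => max 0 (n * s x - (i : ℝ)))]
  have h1 : 0 ≤ n * s x := mul_nonneg n.cast_nonneg (hs x).1
  have h2 : n * s x ≤ n := mul_le_of_le_one_right n.cast_nonneg (hs x).2
  rw [Nat.cast_zero, sub_zero, max_eq_right h1, max_eq_left (by linarith), sub_zero]
  rfl

variable {X : Type*} [NormedAddCommGroup X] [NormedSpace ℝ X]

/-- Bilinear maps are additive along families of mutually annihilating pairs. -/
theorem map_sum_map_sum {R : Type*} [NonUnitalNonAssocRing R] [Module ℝ R]
    (W : R →ₗ[ℝ] R →ₗ[ℝ] X) (h0 : ∀ f g, f * g = 0 → W f g = 0) {ι : Type*} (t : Finset ι)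
    (f g : ι → R) (hfg : ∀ i ∈ t, ∀ j ∈ t, i ≠ j → f i * g j = 0) :
    W (∑ i ∈ t, f i) (∑ j ∈ t, g j) = ∑ i ∈ t, W (f i) (g i) := by
  rw [map_sum W, LinearMap.sum_apply]
  refine Finset.sum_congr rfl fun i hi => ?_
  rw [map_sum]
  exact Finset.sum_eq_single_of_mem i hi fun j hj hji => h0 _ _ (hfg i hi j hj hji.symm)

/-- A bounded bilinear map on `C(K)` which vanishes on zero-products is balanced. -/
theorem continuousMap_balanced [CompactSpace K] (W : C(K, ℝ) →ₗ[ℝ] C(K, ℝ) →ₗ[ℝ] X) (L : ℝ)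
    (hW : ∀ f g, ‖W f g‖ ≤ L * ‖f‖ * ‖g‖) (h0 : ∀ f g, f * g = 0 → W f g = 0) (s : C(K, ℝ))
    (hs : ∀ x, 0 ≤ s x ∧ s x ≤ 1) : W s 1 = W 1 s := by
  -- The sign of `L` is not assumed; a negative bound forces `W = 0`.
  have hL : 0 ≤ L ∨ ∀ f g, W f g = 0 := by
    refine (le_or_gt 0 L).imp_right fun hL f g => ?_
    have h1 : ‖f‖ * ‖g‖ * L ≤ 0 := mul_nonpos_of_nonneg_of_nonpos (by positivity) hL.le
    exact norm_le_zero_iff.mp ((hW f g).trans (by linarith))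
  rcases hL with hL | hL
  swap
  · rw [hL, hL]
  -- Each ramp equals 1 wherever a later one is nonzero, so inside `W` an argument 1 may be
  -- exchanged for an earlier ramp.
  have hcell : ∀ n i, W (ramp s n (i + 1)) 1 - W 1 (ramp s n (i + 1)) =
      W (tent s n (i + 1)) (tent s n i) - W (tent s n i) (tent s n (i + 1)) := by
    intro n i
    have e0 : ramp s n (i + 1) * (1 - ramp s n i) = 0 := ramp_succ_mul_one_sub_ramp s n i
    have e1 : ramp s n (i + 2) * (1 - ramp s n (i + 1)) = 0 := ramp_succ_mul_one_sub_ramp s n (i + 1)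
    have e2 : ramp s n (i + 2) * (1 - ramp s n i) = 0 := by
      ext x
      rcases ramp_eq_zero_or_eq_one s n (show i < i + 2 by lia) x with h | h <;> simp [h]
    have a0 := h0 _ _ e0
    have a1 := h0 _ _ e1
    have a2 := h0 _ _ e2
    have b0 := h0 _ _ ((mul_comm _ _).trans e0)
    have b1 := h0 _ _ ((mul_comm _ _).trans e1)
    have b2 := h0 _ _ ((mul_comm _ _).trans e2)
    simp only [tent, map_sub, LinearMap.sub_apply] at a0 a1 a2 b0 b1 b2 ⊢
    linear_combination (norm := module) a0 - b0 + a1 - a2 + b2 - b1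
  -- Indices 3 apart keep `i + 1` and `j` at least 2 apart. The cross terms then vanish, and the sum
  -- is `W` at two functions of norm at most 1, whatever the size of `t`.
  have hclass : ∀ (n : ℕ) (t : Finset ℕ), (∀ i ∈ t, ∀ j ∈ t, i ≠ j → i + 3 ≤ j ∨ j + 3 ≤ i) →
      ‖∑ i ∈ t, (W (ramp s n (i + 1)) 1 - W 1 (ramp s n (i + 1)))‖ ≤ 2 * L := by
    intro n t ht
    simp only [hcell]
    have hsum : ‖∑ i ∈ t, tent s n i‖ ≤ 1 := norm_sum_tent_le s n t
    have hsum' : ‖∑ i ∈ t, tent s n (i + 1)‖ ≤ 1 := by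
      simpa using norm_sum_tent_le s n (t.map (addRightEmbedding 1))
    have h1 := hW (∑ i ∈ t, tent s n (i + 1)) (∑ i ∈ t, tent s n i)
    have h2 := hW (∑ i ∈ t, tent s n i) (∑ i ∈ t, tent s n (i + 1))
    rw [map_sum_map_sum W h0] at h1 h2
    · rw [Finset.sum_sub_distrib]
      refine (norm_sub_le _ _).trans ?_
      have h3 : L * ‖∑ i ∈ t, tent s n i‖ * ‖∑ i ∈ t, tent s n (i + 1)‖ ≤ L * 1 * 1 := by gcongr
      linarith
    · exact fun i hi j hj hij => tent_mul_tent s n (by have := ht i hi j hj hij; lia)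
    · exact fun i hi j hj hij => tent_mul_tent s n (by have := ht i hi j hj hij; lia)
  -- Three residue classes modulo 3 contribute at most `2 L` each. The bound is independent of `n`,
  -- which forces the defect to vanish.
  have hn : ∀ n : ℕ, n * ‖W s 1 - W 1 s‖ ≤ 6 * L := by
    intro n
    have e : (n : ℝ) • (W s 1 - W 1 s) =
        ∑ i ∈ Finset.range n, (W (ramp s n (i + 1)) 1 - W 1 (ramp s n (i + 1))) := by
      rw [Finset.sum_sub_distrib, ← LinearMap.sum_apply, ← map_sum W, ← map_sum, sum_ramp s hs n]
      simp [smul_sub]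
    rw [← Finset.sum_fiberwise_of_maps_to (t := Finset.range 3) (g := fun i => i % 3)
      (fun i _ => by simpa using Nat.mod_lt i three_pos)] at e
    have h := congrArg norm e
    rw [norm_smul, RCLike.norm_natCast] at h
    rw [h]
    refine (norm_sum_le_of_le (Finset.range 3) fun r _ => hclass n _ ?_).trans ?_
    · intro i hi j hj hij
      simp only [Finset.mem_filter] at hi hj
      lia
    · simp
      linarith
  by_contra hne
  have hpos : 0 < ‖W s 1 - W 1 s‖ := norm_pos_iff.mpr (sub_ne_zero.mpr hne)
  obtain ⟨n, hn'⟩ := exists_nat_gt (6 * L / ‖W s 1 - W 1 s‖)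
  rw [div_lt_iff₀ hpos] at hn'
  linarith [hn n]

/-- A bounded bilinear map on a unital C⋆-algebra which vanishes on zero-products is balanced over
the unit. -/
theorem unital_balanced {M : Type*} [CStarAlgebra M] {X : Type*} [NormedAddCommGroup X]
    [NormedSpace ℂ X] (W : M →L[ℂ] M →L[ℂ] X) (h0 : ∀ x y, x * y = 0 → W x y = 0) (c : M) :
    W c 1 = W 1 c := by
  rcases subsingleton_or_nontrivial M with _ | _
  · rw [Subsingleton.elim c 1]
  let _ : PartialOrder M := CStarAlgebra.spectralOrder M
  have _ : StarOrderedRing M := CStarAlgebra.spectralOrderedRing M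
  have hc : c ∈ Submodule.span ℂ ({x : M | 0 ≤ x} ∩ Metric.closedBall 0 1) := by
    rw [CStarAlgebra.span_nonneg_inter_unitClosedBall]
    trivial
  induction hc using Submodule.span_induction with
  | mem c hc =>
    obtain ⟨hc0 : 0 ≤ c, hc1⟩ := hc
    rw [mem_closedBall_zero_iff] at hc1
    have hsa : IsSelfAdjoint c := IsSelfAdjoint.of_nonneg hc0
    let Θ : C(spectrum ℝ c, ℝ) →⋆ₐ[ℝ] M := cfcHom hsa
    have hΘ : ∀ f, ‖Θ f‖ = ‖f‖ := fun f => norm_cfcHom c f hsa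
    let W' : C(spectrum ℝ c, ℝ) →ₗ[ℝ] C(spectrum ℝ c, ℝ) →ₗ[ℝ] X :=
      LinearMap.mk₂ ℝ (fun f g => W (Θ f) (Θ g)) (by simp) (by simp) (by simp) (by simp)
    have h := continuousMap_balanced W' ‖W‖
      (fun f g => by
        rw [← hΘ f, ← hΘ g]
        exact W.le_opNorm₂ (Θ f) (Θ g))
      (fun f g hfg => h0 _ _ (by rw [← map_mul, hfg, map_zero]))
      (.restrict (spectrum ℝ c) (.id ℝ)) (fun x => by
        refine ⟨spectrum_nonneg_of_nonneg hc0 x.2, (le_abs_self _).trans ?_⟩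
        exact (spectrum.norm_le_norm_of_mem x.2).trans hc1)
    have h1 : Θ (.restrict (spectrum ℝ c) (.id ℝ)) = c := cfcHom_id hsa
    change W (Θ _) (Θ 1) = W (Θ 1) (Θ _) at h
    rwa [h1, map_one] at h
  | zero => simp
  | add x y _ _ hx hy => simp [hx, hy]
  | smul t x _ hx => simp [hx]

/-- A bounded bilinear map on a C⋆-algebra which vanishes on zero-products is balanced. -/
theorem balanced_of_map_zero_product {A : Type*} [NonUnitalCStarAlgebra A] {X : Type*}
    [NormedAddCommGroup X] [NormedSpace ℂ X] (V : A →L[ℂ] A →L[ℂ] X)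
    (h0 : ∀ x y, x * y = 0 → V x y = 0) (a b c : A) : V (a * c) b = V a (c * b) := by
  let snd : Unitization ℂ A →L[ℂ] A := ⟨Unitization.sndHom ℂ ℂ A, Unitization.continuous_snd⟩
  have hsnd : ∀ x : Unitization ℂ A, x.fst = 0 → ((snd x : A) : Unitization ℂ A) = x := by
    intro x hx
    ext
    · simp [hx]
    · rfl
  have hinr : ∀ x : A, snd (x : Unitization ℂ A) = x := fun x => rfl
  let l := snd ∘L ContinuousLinearMap.mul ℂ (Unitization ℂ A) a
  let r := snd ∘L (ContinuousLinearMap.mul ℂ (Unitization ℂ A)).flip b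
  -- The form `(x, y) ↦ V (a x) (y b)` makes sense on the unitization because `A` is an ideal there,
  -- and `x y = 0` gives `(a x) (y b) = 0`.
  have h := unital_balanced (V.bilinearComp l r) (fun x y hxy => h0 _ _ ?_) c
  · change V (snd ((a : Unitization ℂ A) * c)) (snd (1 * (b : Unitization ℂ A))) =
      V (snd ((a : Unitization ℂ A) * 1)) (snd ((c : Unitization ℂ A) * b)) at h
    rwa [one_mul, mul_one, ← Unitization.inr_mul, ← Unitization.inr_mul, hinr, hinr, hinr,
      hinr] at h
  · apply Unitization.inr_injective (R := ℂ)
    change ((snd ((a : Unitization ℂ A) * x) * snd (y * (b : Unitization ℂ A)) : A) :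
      Unitization ℂ A) = _
    rw [Unitization.inr_mul, hsnd _ (by simp), hsnd _ (by simp), mul_assoc, ← mul_assoc x, hxy,
      zero_mul, mul_zero, Unitization.inr_zero]

end ZeroProduct

/-! ### Polynomial approximation of division by `k` -/

section Iteration

/-- The iteration whose `n`-th term is `T g`, where `g k = 1 - (1 - t k) ^ n`. -/
def divSeq {R : Type*} [NonUnitalRing R] [Module ℂ R] (t : ℂ) (k T : R) : ℕ → R
  | 0 => 0
  | n + 1 => divSeq t k T n + t • (T - divSeq t k T n * k)

/-- The recursion involves no unit, so it can be run in the bidual and estimated in `D`. -/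
theorem map_divSeq {R S : Type*} [NonUnitalRing R] [Module ℂ R] [NonUnitalRing S] [Module ℂ S]
    (Φ : R →ₗ[ℂ] S) (hΦ : ∀ x y, Φ (x * y) = Φ x * Φ y) (t : ℂ) (k T : R) (n : ℕ) :
    Φ (divSeq t k T n) = divSeq t (Φ k) (Φ T) n := by
  induction n with
  | zero => simp [divSeq]
  | succ n ih => simp [divSeq, ih, hΦ]

theorem divSeq_add {R : Type*} [NonUnitalRing R] [Module ℂ R] (t : ℂ) (k T T' : R) (n : ℕ) :
    divSeq t k (T + T') n = divSeq t k T n + divSeq t k T' n := by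
  induction n with
  | zero => simp [divSeq]
  | succ n ih =>
    simp only [divSeq, ih, add_mul]
    module

theorem divSeq_smul {R : Type*} [NonUnitalRing R] [Module ℂ R] [IsScalarTower ℂ R R]
    (t c : ℂ) (k T : R) (n : ℕ) : divSeq t k (c • T) n = c • divSeq t k T n := by
  induction n with
  | zero => simp [divSeq]
  | succ n ih =>
    simp only [divSeq, ih, smul_mul_assoc]
    module

theorem divSeq_mul_eq_zero {R : Type*} [NonUnitalRing R] [Module ℂ R] [IsScalarTower ℂ R R]
    (t : ℂ) {k T x : R} (hk : k * x = 0) (hT : T * x = 0) (n : ℕ) : divSeq t k T n * x = 0 := by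
  induction n with
  | zero => simp [divSeq]
  | succ n ih => simp [divSeq, add_mul, sub_mul, smul_mul_assoc, ih, mul_assoc, hk, hT]

variable {D : Type*} [Ring D] [Algebra ℂ D]

theorem divSeq_eq (t : ℂ) (k T : D) (n : ℕ) :
    divSeq t k T n = T * (t • ∑ j ∈ Finset.range n, (1 - t • k) ^ j) := by
  induction n with
  | zero => simp [divSeq]
  | succ n ih =>
    have h := geom_sum_mul_neg (1 - t • k) n
    rw [sub_sub_cancel, mul_smul_comm, ← smul_mul_assoc] at h
    rw [divSeq, ih, Finset.sum_range_succ, smul_add, mul_add, mul_assoc, h]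
    simp only [mul_sub, mul_one, mul_smul_comm, sub_sub_cancel]

end Iteration

/-! ### Algebra and order estimates of a balanced pair -/

section BalancedPair

variable {M D : Type*} [CStarAlgebra M] [CStarAlgebra D]

/-- `‖a‖² - a* a` is a square `d* d`. -/
theorem exists_star_mul_self_eq_sub [PartialOrder M] [StarOrderedRing M] (a : M) :
    ∃ d : M, star d * d = ((‖a‖ ^ 2 : ℝ) : ℂ) • (1 : M) - star a * a := by
  have h1 : 0 ≤ algebraMap ℝ M (‖a‖ ^ 2) - star a * a :=
    sub_nonneg.mpr CStarAlgebra.star_mul_le_algebraMap_norm_sq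
  obtain ⟨d, hd⟩ := CStarAlgebra.nonneg_iff_eq_star_mul_self.mp h1
  refine ⟨d, ?_⟩
  rw [← hd, Algebra.algebraMap_eq_smul_one, Complex.coe_smul]

/-- A pair of linear maps, adjoint to each other, all of whose products are balanced. -/
structure BalancedPair (P Q : M →ₗ[ℂ] D) : Prop where
  star_left : ∀ x, star (P x) = Q (star x)
  left_left : ∀ a b, P a * P b = P 1 * P (a * b)
  left_right : ∀ a b, P a * Q b = P 1 * Q (a * b)
  right_left : ∀ a b, Q a * P b = Q 1 * P (a * b)
  right_right : ∀ a b, Q a * Q b = Q 1 * Q (a * b)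

/-- The map `a ↦ P a Q 1 + Q a P 1`. -/
def pairMap (P Q : M →ₗ[ℂ] D) : M →ₗ[ℂ] D :=
  LinearMap.mulRight ℂ (Q 1) ∘ₗ P + LinearMap.mulRight ℂ (P 1) ∘ₗ Q

theorem pairMap_apply (P Q : M →ₗ[ℂ] D) (a : M) : pairMap P Q a = P a * Q 1 + Q a * P 1 := rfl

theorem pairMap_comm (P Q : M →ₗ[ℂ] D) : pairMap Q P = pairMap P Q := add_comm _ _

namespace BalancedPair

variable {P Q : M →ₗ[ℂ] D}

theorem symm (h : BalancedPair P Q) : BalancedPair Q P where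
  star_left x := by rw [← star_star (P (star x)), h.star_left, star_star]
  left_left := h.right_right
  left_right := h.right_left
  right_left := h.left_right
  right_right := h.left_left

/-- Balancing moves `a` past the middle factor 1 and then into the argument of `P b`: `P a Q 1 P b =
P 1 Q a P b = P 1 Q 1 P (a b)`, and likewise for the other summand. -/
theorem pairMap_mul_left (h : BalancedPair P Q) (a b : M) :
    pairMap P Q a * P b = pairMap P Q 1 * P (a * b) := by
  simp only [pairMap_apply, add_mul]
  rw [h.left_right a 1, h.right_left a 1, mul_one]
  simp only [mul_assoc]
  rw [h.right_left a b, h.left_left a b]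

theorem pairMap_mul_right (h : BalancedPair P Q) (a b : M) :
    pairMap P Q a * Q b = pairMap P Q 1 * Q (a * b) := by
  rw [← pairMap_comm]
  exact h.symm.pairMap_mul_left a b

theorem pairMap_mul_pairMap (h : BalancedPair P Q) (a b : M) :
    pairMap P Q a * pairMap P Q b = pairMap P Q 1 * pairMap P Q (a * b) := by
  rw [pairMap_apply P Q b, mul_add, ← mul_assoc, ← mul_assoc, h.pairMap_mul_left,
    h.pairMap_mul_right, mul_assoc, mul_assoc, ← mul_add, ← pairMap_apply]

theorem pairMap_mul_one (h : BalancedPair P Q) (a : M) :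
    pairMap P Q a * pairMap P Q 1 = pairMap P Q 1 * pairMap P Q a := by
  rw [h.pairMap_mul_pairMap, mul_one]

theorem star_pairMap (h : BalancedPair P Q) (a : M) :
    star (pairMap P Q a) = pairMap P Q (star a) := by
  simp only [pairMap_apply, star_add, star_mul, h.star_left, h.symm.star_left, star_one]
  rw [h.left_right 1, h.right_left 1, one_mul, h.left_right _ 1, h.right_left _ 1, mul_one]

theorem star_divSeq (h : BalancedPair P Q) (t : ℝ) (a : M) (n : ℕ) :
    star (divSeq (t : ℂ) (pairMap P Q 1) (pairMap P Q a) n) =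
      divSeq (t : ℂ) (pairMap P Q 1) (pairMap P Q (star a)) n := by
  have hk : star (pairMap P Q 1) = pairMap P Q 1 := by rw [h.star_pairMap, star_one]
  have hc : Commute (pairMap P Q 1) (pairMap P Q (star a)) := (h.pairMap_mul_one _).symm
  rw [divSeq_eq, divSeq_eq, star_mul, h.star_pairMap]
  have hs : star ((t : ℂ) • ∑ j ∈ Finset.range n, (1 - (t : ℂ) • pairMap P Q 1) ^ j) =
      (t : ℂ) • ∑ j ∈ Finset.range n, (1 - (t : ℂ) • pairMap P Q 1) ^ j := by
    simp [star_sum, star_pow, hk]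
  rw [hs]
  have h1 : Commute (1 - (t : ℂ) • pairMap P Q 1) (pairMap P Q (star a)) :=
    (Commute.one_left _).sub_left (hc.smul_left _)
  exact (Commute.sum_left _ _ _ fun j _ => h1.pow_left j).smul_left _

theorem pairMap_one_eq (h : BalancedPair P Q) :
    pairMap P Q 1 = P 1 * star (P 1) + star (P 1) * P 1 := by
  rw [h.star_left, star_one, pairMap_apply]

theorem pairMap_one_nonneg (h : BalancedPair P Q) [PartialOrder D] [StarOrderedRing D] :
    0 ≤ pairMap P Q 1 := by
  rw [h.pairMap_one_eq]
  exact add_nonneg (mul_star_self_nonneg _) (star_mul_self_nonneg _)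

variable [PartialOrder M] [StarOrderedRing M] [PartialOrder D] [StarOrderedRing D]

/-- With `T = pairMap P Q`, `k = T 1` and `d* d = ‖a‖² - a* a`, the difference of the two sides is
`k T (d* d) = (T d)* T d`. -/
theorem star_pairMap_mul_le (h : BalancedPair P Q) (a : M) :
    star (pairMap P Q a) * pairMap P Q a ≤
      ((‖a‖ ^ 2 : ℝ) : ℂ) • (pairMap P Q 1 * pairMap P Q 1) := by
  obtain ⟨d, hd⟩ := exists_star_mul_self_eq_sub a
  have h1 := star_mul_self_nonneg (pairMap P Q d)
  rw [h.star_pairMap, h.pairMap_mul_pairMap, hd, map_sub, map_smul, mul_sub, mul_smul_comm,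
    ← h.pairMap_mul_pairMap, ← h.star_pairMap] at h1
  exact sub_nonneg.mp h1

/-- Since `P x (P x)* = P 1 Q (x x*)`, positivity at `x = d*` with `d* d = ‖b‖² - b b*` is the
claim. -/
theorem mul_star_left_le (h : BalancedPair P Q) (b : M) :
    P b * star (P b) ≤ ((‖b‖ ^ 2 : ℝ) : ℂ) • (P 1 * star (P 1)) := by
  obtain ⟨d, hd⟩ := exists_star_mul_self_eq_sub (star b)
  have h1 := mul_star_self_nonneg (P (star d))
  rw [norm_star, star_star] at hd
  rw [h.star_left, h.left_right, star_star, hd, map_sub, map_smul, mul_sub, mul_smul_comm] at h1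
  rw [h.star_left, h.left_right, h.star_left, star_one]
  exact sub_nonneg.mp h1

theorem mul_star_left_le_pairMap (h : BalancedPair P Q) (b : M) :
    P b * star (P b) ≤ ((‖b‖ ^ 2 : ℝ) : ℂ) • pairMap P Q 1 := by
  refine (h.mul_star_left_le b).trans ?_
  rw [h.pairMap_one_eq, Complex.coe_smul, Complex.coe_smul]
  gcongr
  exact le_add_of_nonneg_right (star_mul_self_nonneg _)

end BalancedPair

end BalancedPair

/-! ### Functional calculus bounds on `[0, 1]` -/

section Contraction

variable {D : Type*} [CStarAlgebra D] [PartialOrder D] [StarOrderedRing D]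

theorem spectrum_subset_unitInterval {x : D} (h0 : 0 ≤ x) (h1 : x ≤ 1) {s : ℝ}
    (hs : s ∈ spectrum ℝ x) : 0 ≤ s ∧ s ≤ 1 := by
  refine ⟨spectrum_nonneg_of_nonneg h0 hs, ?_⟩
  have := (le_algebraMap_iff_spectrum_le (r := (1 : ℝ)) (a := x)).mp (by simpa using h1)
  exact this s hs

theorem norm_one_sub_pow_le {x : D} (h0 : 0 ≤ x) (h1 : x ≤ 1) (n : ℕ) : ‖1 - x ^ n‖ ≤ 1 := by
  have e : 1 - x ^ n = cfc (fun s : ℝ => 1 - s ^ n) x := by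
    rw [cfc_sub (fun _ => (1 : ℝ)) (fun s => s ^ n) x, cfc_const_one ℝ x, cfc_pow_id x n]
  rw [e]
  refine norm_cfc_le zero_le_one fun s hs => ?_
  obtain ⟨hs0, hs1⟩ := spectrum_subset_unitInterval h0 h1 hs
  have := pow_le_one₀ (n := n) hs0 hs1
  have := pow_nonneg hs0 n
  rw [Real.norm_of_nonneg (by linarith)]
  linarith

theorem norm_pow_mul_one_sub_mul_pow_le {x : D} (h0 : 0 ≤ x) (h1 : x ≤ 1) (n : ℕ) :
    ‖x ^ n * (1 - x) * x ^ n‖ ≤ 1 / (n + 1) := by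
  have e : x ^ n * (1 - x) * x ^ n = cfc (fun s : ℝ => s ^ n * (1 - s) * s ^ n) x := by
    rw [cfc_mul (fun s : ℝ => s ^ n * (1 - s)) (fun s => s ^ n) x,
      cfc_mul (fun s : ℝ => s ^ n) (fun s => 1 - s) x,
      cfc_sub (fun _ => (1 : ℝ)) (fun s => s) x, cfc_const_one ℝ x, cfc_pow_id x n, cfc_id' ℝ x]
  rw [e]
  refine norm_cfc_le (by positivity) fun s hs => ?_
  obtain ⟨hs0, hs1⟩ := spectrum_subset_unitInterval h0 h1 hs
  have hp := pow_nonneg hs0 n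
  have hp1 := pow_le_one₀ (n := n) hs0 hs1
  rw [Real.norm_of_nonneg (by have := sub_nonneg.mpr hs1; positivity), le_div_iff₀ (by positivity)]
  -- Each of the `n + 1` terms of `∑_{j ≤ n} s ^ j` is at least `s ^ n`, and the sum times `1 - s`
  -- is `1 - s ^ (n + 1)`.
  have hgeom : (n + 1) * s ^ n * (1 - s) ≤ 1 := by
    have hg := geom_sum_mul_neg s (n + 1)
    have hle : ((n + 1 : ℕ) : ℝ) * s ^ n ≤ ∑ j ∈ Finset.range (n + 1), s ^ j := by
      rw [← nsmul_eq_mul]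
      nth_rewrite 1 [← Finset.card_range (n + 1)]
      refine Finset.card_nsmul_le_sum (Finset.range (n + 1)) _ _ fun j hj => ?_
      exact pow_le_pow_of_le_one hs0 hs1 (by simpa [Nat.lt_succ_iff] using hj)
    have := pow_nonneg hs0 (n + 1)
    push_cast at hle
    nlinarith [mul_le_mul_of_nonneg_right hle (sub_nonneg.mpr hs1)]
  nlinarith [mul_le_mul_of_nonneg_left hp1 (by
    have := sub_nonneg.mpr hs1; positivity : 0 ≤ (n + 1) * s ^ n * (1 - s))]

end Contraction

/-! ### Boundedness and convergence of the iteration -/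

section Convergence

variable {M D : Type*} [CStarAlgebra M] [CStarAlgebra D] {P Q : M →ₗ[ℂ] D}

namespace BalancedPair

theorem norm_divSeq_le [PartialOrder M] [StarOrderedRing M] [PartialOrder D] [StarOrderedRing D]
    (h : BalancedPair P Q) {t : ℝ} (ht0 : 0 ≤ 1 - (t : ℂ) • pairMap P Q 1)
    (ht1 : 1 - (t : ℂ) • pairMap P Q 1 ≤ 1) (a : M) (n : ℕ) :
    ‖divSeq (t : ℂ) (pairMap P Q 1) (pairMap P Q a) n‖ ≤ ‖a‖ := by
  set x := 1 - (t : ℂ) • pairMap P Q 1 with hx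
  have hk : star (pairMap P Q 1) = pairMap P Q 1 := by rw [h.star_pairMap, star_one]
  have hxs : star x = x := (IsSelfAdjoint.of_nonneg ht0).star_eq
  rw [divSeq_eq, ← hx]
  set g := (t : ℂ) • ∑ j ∈ Finset.range n, x ^ j with hg
  have hgs : star g = g := by simp [hg, star_sum, star_pow, hxs]
  have hgk : pairMap P Q 1 * g = 1 - x ^ n := by
    rw [hg, mul_smul_comm, ← smul_mul_assoc, ← mul_neg_geom_sum x n, hx, sub_sub_cancel]
  have hkg : g * pairMap P Q 1 = 1 - x ^ n := by
    have := congrArg star hgk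
    simpa [hk, hgs, hxs] using this
  clear_value g
  -- Conjugating `(T a)* T a ≤ ‖a‖² k²` by `g` leaves `g k k g = (1 - x ^ n)²`.
  have h1 : star (pairMap P Q a * g) * (pairMap P Q a * g) ≤
      ((‖a‖ ^ 2 : ℝ) : ℂ) • ((1 - x ^ n) * (1 - x ^ n)) := by
    have h2 := star_left_conjugate_le_conjugate (h.star_pairMap_mul_le a) g
    rw [hgs] at h2
    calc _ = g * (star (pairMap P Q a) * pairMap P Q a) * g := by
          rw [star_mul, hgs]; simp only [mul_assoc]
      _ ≤ _ := h2
      _ = _ := by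
        rw [mul_smul_comm, smul_mul_assoc, ← mul_assoc, hkg, mul_assoc, hgk]
  have h3 := CStarAlgebra.norm_le_norm_of_nonneg_of_le (star_mul_self_nonneg _) h1
  have h4 := norm_one_sub_pow_le ht0 ht1 n
  rw [CStarRing.norm_star_mul_self, norm_smul, Complex.norm_real, Real.norm_of_nonneg
    (by positivity)] at h3
  have h5 : ‖(1 - x ^ n) * (1 - x ^ n)‖ ≤ 1 :=
    (norm_mul_le _ _).trans (mul_le_one₀ h4 (norm_nonneg _) h4)
  refine abs_le_of_sq_le_sq' ?_ (norm_nonneg a) |>.2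
  nlinarith [mul_le_mul_of_nonneg_left h5 (sq_nonneg ‖a‖)]

theorem tendsto_divSeq_mul_left [PartialOrder M] [StarOrderedRing M] [PartialOrder D]
    [StarOrderedRing D] (h : BalancedPair P Q) {t : ℝ} (ht : 0 < t)
    (ht0 : 0 ≤ 1 - (t : ℂ) • pairMap P Q 1) (ht1 : 1 - (t : ℂ) • pairMap P Q 1 ≤ 1) (a b : M) :
    Tendsto (fun n => divSeq (t : ℂ) (pairMap P Q 1) (pairMap P Q a) n * P b) atTop
      (𝓝 (P (a * b))) := by
  set x := 1 - (t : ℂ) • pairMap P Q 1 with hx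
  have hxs : star x = x := (IsSelfAdjoint.of_nonneg ht0).star_eq
  have hxk : pairMap P Q 1 = ((t⁻¹ : ℝ) : ℂ) • (1 - x) := by
    rw [hx, sub_sub_cancel, smul_smul, ← Complex.ofReal_mul, inv_mul_cancel₀ ht.ne',
      Complex.ofReal_one, one_smul]
  have hform : ∀ n, divSeq (t : ℂ) (pairMap P Q 1) (pairMap P Q a) n * P b =
      P (a * b) - x ^ n * P (a * b) := by
    intro n
    have hc : Commute x (pairMap P Q a) :=
      (Commute.one_left _).sub_left (Commute.smul_left (h.pairMap_mul_one a).symm _)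
    have hg : Commute ((t : ℂ) • ∑ j ∈ Finset.range n, x ^ j) (pairMap P Q a) :=
      (Commute.sum_left _ _ _ fun j _ => hc.pow_left j).smul_left _
    rw [divSeq_eq, ← hx, ← hg.eq, mul_assoc, h.pairMap_mul_left, ← mul_assoc]
    have : ((t : ℂ) • ∑ j ∈ Finset.range n, x ^ j) * pairMap P Q 1 = 1 - x ^ n := by
      rw [smul_mul_assoc, ← mul_smul_comm, ← geom_sum_mul_neg x n, hx, sub_sub_cancel]
    rw [this, sub_mul, one_mul]
  simp only [hform]
  rw [tendsto_iff_norm_sub_tendsto_zero]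
  set c := P (a * b) with hc
  -- The error is `x ^ n c`. Its square norm is controlled through `c c* ≤ ‖a b‖² k` and `k = t⁻¹ (1
  -- - x)`.
  have hbound : ∀ n : ℕ, ‖c - x ^ n * c - c‖ ^ 2 ≤ (‖a * b‖ ^ 2 * t⁻¹) * (1 / ((n : ℝ) + 1)) := by
    intro n
    rw [sub_sub_cancel_left, norm_neg, sq, ← CStarRing.norm_self_mul_star, star_mul, star_pow, hxs]
    have h1 : x ^ n * c * (star c * x ^ n) ≤
        ((‖a * b‖ ^ 2 * t⁻¹ : ℝ) : ℂ) • (x ^ n * (1 - x) * x ^ n) := by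
      have h2 := star_right_conjugate_le_conjugate (h.mul_star_left_le_pairMap (a * b)) (x ^ n)
      rw [star_pow, hxs] at h2
      calc _ = x ^ n * (c * star c) * x ^ n := by simp only [mul_assoc]
        _ ≤ _ := h2
        _ = _ := by
          rw [hxk, smul_smul, ← Complex.ofReal_mul, mul_smul_comm, smul_mul_assoc]
    have h0 : 0 ≤ x ^ n * c * (star c * x ^ n) := by
      have := mul_star_self_nonneg (x ^ n * c)
      rwa [star_mul, star_pow, hxs] at this
    refine (CStarAlgebra.norm_le_norm_of_nonneg_of_le h0 h1).trans ?_
    rw [norm_smul, Complex.norm_real, Real.norm_of_nonneg (by positivity)]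
    exact mul_le_mul_of_nonneg_left (norm_pow_mul_one_sub_mul_pow_le ht0 ht1 n) (by positivity)
  have hlim : Tendsto (fun n : ℕ => (‖a * b‖ ^ 2 * t⁻¹) * (1 / ((n : ℝ) + 1))) atTop (𝓝 0) := by
    simpa using tendsto_one_div_add_atTop_nhds_zero_nat.const_mul (‖a * b‖ ^ 2 * t⁻¹)
  have hsq := squeeze_zero (fun n => sq_nonneg _) hbound hlim
  have := (Real.continuous_sqrt.tendsto 0).comp hsq
  simpa [Function.comp_def, Real.sqrt_sq] using this

/-- The iteration attached to a balanced pair is bounded, and it converges on the ranges. -/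
theorem exists_divSeq_tendsto (h : BalancedPair P Q) : ∃ t : ℝ, ∀ a : M,
    (∀ n, ‖divSeq (t : ℂ) (pairMap P Q 1) (pairMap P Q a) n‖ ≤ ‖a‖) ∧
    (∀ b, Tendsto (fun n => divSeq (t : ℂ) (pairMap P Q 1) (pairMap P Q a) n * P b) atTop
      (𝓝 (P (a * b)))) ∧
    ∀ b, Tendsto (fun n => divSeq (t : ℂ) (pairMap P Q 1) (pairMap P Q a) n * Q b) atTop
      (𝓝 (Q (a * b))) := by
  let _ : PartialOrder M := CStarAlgebra.spectralOrder M
  have _ : StarOrderedRing M := CStarAlgebra.spectralOrderedRing M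
  let _ : PartialOrder D := CStarAlgebra.spectralOrder D
  have _ : StarOrderedRing D := CStarAlgebra.spectralOrderedRing D
  have hk := h.pairMap_one_nonneg
  -- This scaling gives `0 ≤ t k ≤ 1`; the added 1 covers `k = 0`.
  set t : ℝ := (‖pairMap P Q 1‖ + 1)⁻¹ with ht
  have ht' : 0 < t := by positivity
  have hnn : 0 ≤ (t : ℂ) • pairMap P Q 1 := by
    rw [Complex.coe_smul]; exact smul_nonneg ht'.le hk
  have hle : (t : ℂ) • pairMap P Q 1 ≤ 1 := by
    refine (CStarAlgebra.norm_le_one_iff_of_nonneg _ hnn).mp ?_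
    rw [norm_smul, Complex.norm_real, Real.norm_of_nonneg ht'.le, ht, inv_mul_le_one₀
      (by positivity)]
    linarith
  have ht0 := sub_nonneg.mpr hle
  have ht1 : 1 - (t : ℂ) • pairMap P Q 1 ≤ 1 := sub_le_self _ hnn
  refine ⟨t, fun a => ⟨h.norm_divSeq_le ht0 ht1 a, h.tendsto_divSeq_mul_left ht' ht0 ht1 a, ?_⟩⟩
  rw [← pairMap_comm P Q] at ht0 ht1 ⊢
  exact h.symm.tendsto_divSeq_mul_left ht' ht0 ht1 a

end BalancedPair

end Convergence

local notation "κ" => inclusionInDoubleDual ℂ _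

/-! ### ⋆-algebra and weak⋆ limits in the bidual -/

section BidualAlgebra

variable {B : Type v} [NonUnitalCStarAlgebra B]

instance isScalarTower_bidual : IsScalarTower ℂ (Bidual B) (Bidual B) := ⟨fun _ _ _ => rfl⟩

instance smulCommClass_bidual : SMulCommClass ℂ (Bidual B) (Bidual B) where
  smul_comm c F G := by
    ext f
    change c * F (bidualAct G f) = F (bidualAct (c • G) f)
    rw [← smul_eq_mul, ← map_smul]
    rfl

theorem inclusion_mul (a b : B) : (κ (a * b) : Bidual B) = κ a * κ b := rfl

theorem inclusion_star (a : B) : (κ (star a) : Bidual B) = star (κ a) := by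
  ext f
  rw [bidual_star_apply, dual_def, dual_def, dualStar_apply, star_star]

theorem inclusion_injective : Function.Injective (κ : B → Bidual B) :=
  (inclusionInDoubleDualLi ℂ (E := B)).injective

theorem eq_of_embedding_eq {D : Type*} [NormedAddCommGroup D] [Module ℂ D]
    {Φ : Bidual B →ₗ[ℂ] D} (hΦ : ∀ f, ∃ C : ℝ, ∀ F, ‖F f‖ ≤ C * ‖Φ F‖) {F G : Bidual B}
    (h : Φ F = Φ G) : F = G := by
  ext f
  obtain ⟨C, hC⟩ := hΦ f
  have := hC (F - G)
  rw [map_sub, h, sub_self, norm_zero, mul_zero, norm_le_zero_iff] at this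
  exact sub_eq_zero.mp this

/-- This is Arens regularity in disguise. It is not formal from the definition of the product and is
pulled back from the C⋆-algebra `D`. -/
theorem bidual_star_mul (F G : Bidual B) : star (F * G) = star G * star F := by
  obtain ⟨D, _, Φ, hmul, hstar, hΦ⟩ := exists_bidual_embedding.{v, v} B
  apply eq_of_embedding_eq hΦ
  rw [hstar, hmul, star_mul, hmul, hstar, hstar]

theorem bidual_star_star (F : Bidual B) : star (star F) = F := by
  obtain ⟨D, _, Φ, hmul, hstar, hΦ⟩ := exists_bidual_embedding.{v, v} B
  apply eq_of_embedding_eq hΦ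
  rw [hstar, hstar, star_star]

theorem eq_zero_of_mul_star_self {F : Bidual B} (h : F * star F = 0) : F = 0 := by
  obtain ⟨D, _, Φ, hmul, hstar, hΦ⟩ := exists_bidual_embedding.{v, v} B
  apply eq_of_embedding_eq hΦ
  rw [map_zero, ← CStarRing.mul_star_self_eq_zero_iff, ← hstar, ← hmul, h, map_zero]

/-- Convergence in the weak⋆ topology of the bidual. -/
def WeakLim {ι : Type*} (l : Filter ι) (F : ι → Bidual B) (G : Bidual B) : Prop :=
  ∀ f, Tendsto (fun i => F i f) l (𝓝 (G f))

namespace WeakLim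

variable {ι : Type*} {l : Filter ι} {F F' : ι → Bidual B} {G G' : Bidual B}

theorem unique [l.NeBot] (h : WeakLim l F G) (h' : WeakLim l F G') : G = G' := by
  ext f
  exact tendsto_nhds_unique (h f) (h' f)

theorem mul_const (h : WeakLim l F G) (H : Bidual B) : WeakLim l (fun i => F i * H) (G * H) :=
  fun f => h (bidualAct H f)

theorem star (h : WeakLim l F G) : WeakLim l (fun i => star (F i)) (star G) :=
  fun f => (h (dualStar f)).star

/-- The first Arens product is weak⋆ continuous on the left by definition; the involution transfers
this to the right. -/
theorem const_mul (h : WeakLim l F G) (H : Bidual B) : WeakLim l (fun i => H * F i) (H * G) := by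
  have h1 := (h.star.mul_const (Star.star H)).star
  simpa only [← bidual_star_mul, bidual_star_star] using h1

theorem add (h : WeakLim l F G) (h' : WeakLim l F' G') :
    WeakLim l (fun i => F i + F' i) (G + G') :=
  fun f => (h f).add (h' f)

theorem const_smul (h : WeakLim l F G) (c : ℂ) : WeakLim l (fun i => c • F i) (c • G) :=
  fun f => (h f).const_smul c

theorem const (G : Bidual B) : WeakLim l (fun _ => G) G := fun _ => tendsto_const_nhds

theorem inclusion {b : ι → B} {x : B} (h : Tendsto b l (𝓝 x)) :
    WeakLim l (fun i => κ (b i)) (κ x) :=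
  fun f => (f.continuous.tendsto x).comp h

theorem of_embedding {D : Type*} [NormedAddCommGroup D] [Module ℂ D]
    {Φ : Bidual B →ₗ[ℂ] D} (hΦ : ∀ f, ∃ C : ℝ, ∀ F, ‖F f‖ ≤ C * ‖Φ F‖)
    (h : Tendsto (fun i => Φ (F i)) l (𝓝 (Φ G))) : WeakLim l F G := by
  intro f
  obtain ⟨C, hC⟩ := hΦ f
  rw [tendsto_iff_norm_sub_tendsto_zero] at h ⊢
  refine squeeze_zero (fun _ => norm_nonneg _) (fun i => ?_) (by simpa using h.const_mul C)
  simpa using hC (F i - G)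

/-- Bounded families have weak⋆ limits along ultrafilters. -/
theorem exists_of_eventually_bounded (U : Ultrafilter ι) (F : ι → Bidual B) (C : ℝ)
    (hF : ∀ᶠ i in (U : Filter ι), ‖F i‖ ≤ C) : ∃ G, WeakLim U F G := by
  have hlim : ∀ f, ∃ z, Tendsto (fun i => F i f) U (𝓝 z) := by
    intro f
    have hmem : Metric.closedBall (0 : ℂ) (C * ‖f‖) ∈ U.map fun i => F i f := by
      exact Ultrafilter.mem_map.mpr (hF.mono fun i hi =>
        mem_closedBall_zero_iff.mpr ((F i).le_of_opNorm_le hi f))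
    obtain ⟨z, -, hz⟩ := (isCompact_closedBall (0 : ℂ) (C * ‖f‖)).ultrafilter_le_nhds _
      (le_principal_iff.mpr hmem)
    exact ⟨z, hz⟩
  choose z hz using hlim
  refine ⟨LinearMap.mkContinuous
    { toFun := z
      map_add' := fun f g => tendsto_nhds_unique (hz (f + g)) (by
        simpa only [map_add] using (hz f).add (hz g))
      map_smul' := fun c f => tendsto_nhds_unique (hz (c • f)) (by
        simpa only [map_smul, RingHom.id_apply] using (hz f).const_smul c) } C fun f => ?_, hz⟩
  refine le_of_tendsto (hz f).norm ?_
  filter_upwards [hF] with i hi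
  exact (F i).le_of_opNorm_le hi f

end WeakLim

end BidualAlgebra

/-! ### The unit of the bidual -/

section Unit

variable {A : Type u} [NonUnitalCStarAlgebra A]

/-- The bidual has a unit, a weak⋆ limit of an approximate unit. -/
theorem exists_unitElement : ∃ (U : Ultrafilter A) (e : Bidual A), IsUnitElement e ∧
    star e = e ∧ WeakLim (U : Filter A) (fun a => κ a) e ∧
      (∀ a, Tendsto (fun u => u * a) (U : Filter A) (𝓝 a)) ∧
      ∀ a, Tendsto (fun u => a * u) (U : Filter A) (𝓝 a) := by
  let _ : PartialOrder A := CStarAlgebra.spectralOrder A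
  have _ : StarOrderedRing A := CStarAlgebra.spectralOrderedRing A
  have hU := CStarAlgebra.increasingApproximateUnit A
  let U : Ultrafilter A := Ultrafilter.of (CStarAlgebra.approximateUnit A)
  have hle : (U : Filter A) ≤ CStarAlgebra.approximateUnit A := Ultrafilter.of_le _
  have hr : ∀ a, Tendsto (fun u => u * a) (U : Filter A) (𝓝 a) := fun a =>
    (hU.tendsto_mul_right a).mono_left hle
  have hl : ∀ a, Tendsto (fun u => a * u) (U : Filter A) (𝓝 a) := fun a =>
    (hU.tendsto_mul_left a).mono_left hle
  obtain ⟨e, he⟩ := WeakLim.exists_of_eventually_bounded U (fun a => (κ a : Bidual A)) 1 (by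
    filter_upwards [hle hU.eventually_norm] with u hu
    exact (double_dual_bound ℂ A u).trans hu)
  have hright : ∀ F : Bidual A, F * e = F := by
    intro F
    ext f
    rw [bidual_mul_apply]
    congr 1
    ext x
    exact tendsto_nhds_unique (he (dualAct f x)) ((f.continuous.tendsto x).comp (hl x))
  -- The right unit is immediate from the Arens product. Its adjoint is a left unit, so the two
  -- coincide.
  have hleft : ∀ F : Bidual A, star e * F = F := by
    intro F
    rw [← bidual_star_star F, ← bidual_star_mul, hright]
  have hstar : star e = e := by rw [← hright (star e), hleft]
  exact ⟨U, e, fun F => ⟨by conv_lhs => rw [← hstar, hleft], hright F⟩, hstar, he, hr, hl⟩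

end Unit

/-! ### Extension to the unitization -/

section Extension

variable {A : Type u} {B : Type v} [NonUnitalCStarAlgebra A] [NonUnitalCStarAlgebra B]

/-- The adjoint map `a ↦ (φ a*)*`. -/
def adjointMap (φ : A →L[ℂ] B) : A →L[ℂ] B :=
  LinearMap.mkContinuous
    { toFun := fun a => star (φ (star a))
      map_add' := fun x y => by simp
      map_smul' := fun c x => by simp } ‖φ‖
    (fun x => by simpa using φ.le_opNorm (star x))

theorem adjointMap_apply (φ : A →L[ℂ] B) (a : A) : adjointMap φ a = star (φ (star a)) := rfl

theorem weakLim_bitranspose {ι : Type*} {l : Filter ι} {x : ι → A} {F : Bidual A}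
    (h : WeakLim l (fun i => κ (x i)) F) (X : A →L[ℂ] B) :
    WeakLim l (fun i => κ (X (x i))) (bitranspose X F) :=
  fun f => h (f ∘L X)

variable {U : Ultrafilter A} {e : Bidual A}

theorem star_bitranspose (he : WeakLim (U : Filter A) (fun a => κ a) e) (hu : star e = e)
    (φ : A →L[ℂ] B) : star (bitranspose φ e) = bitranspose (adjointMap φ) e := by
  refine (weakLim_bitranspose he φ).star.unique ?_
  have h1 := he.star
  simp only [← inclusion_star, hu] at h1 ⊢
  simpa only [adjointMap_apply, star_star] using weakLim_bitranspose h1 (adjointMap φ)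

/-- Along the approximate unit, `X u * Y (c b) = X (u c) * Y b` tends to `X c * Y b`. -/
theorem bitranspose_mul_inclusion_mul (he : WeakLim (U : Filter A) (fun a => κ a) e)
    (hr : ∀ a, Tendsto (fun u => u * a) (U : Filter A) (𝓝 a)) {X Y : A →L[ℂ] B}
    (h : ∀ a b c, X (a * c) * Y b = X a * Y (c * b)) (c b : A) :
    bitranspose X e * κ (Y (c * b)) = κ (X c * Y b) := by
  refine ((weakLim_bitranspose he X).mul_const _).unique ?_
  simp only [← inclusion_mul, ← h]
  exact WeakLim.inclusion (((X.continuous.tendsto c).comp (hr c)).mul_const (Y b))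

theorem inclusion_mul_bitranspose_mul (he : WeakLim (U : Filter A) (fun a => κ a) e)
    (hl : ∀ a, Tendsto (fun u => a * u) (U : Filter A) (𝓝 a)) {X Y : A →L[ℂ] B}
    (h : ∀ a b c, X (a * c) * Y b = X a * Y (c * b)) (a c : A) :
    κ (X (a * c)) * bitranspose Y e = κ (X a * Y c) := by
  refine ((weakLim_bitranspose he Y).const_mul _).unique ?_
  simp only [← inclusion_mul, h]
  exact WeakLim.inclusion (((Y.continuous.tendsto c).comp (hl c)).const_mul (X a))

theorem bitranspose_mul_inclusion (he : WeakLim (U : Filter A) (fun a => κ a) e)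
    (hr : ∀ a, Tendsto (fun u => u * a) (U : Filter A) (𝓝 a))
    (hl : ∀ a, Tendsto (fun u => a * u) (U : Filter A) (𝓝 a)) {X Y : A →L[ℂ] B}
    (h : ∀ a b c, X (a * c) * Y b = X a * Y (c * b)) (b : A) :
    bitranspose X e * κ (Y b) = κ (X b) * bitranspose Y e := by
  -- With `u b` in place of `b`, both sides equal `κ (X u * Y b)`.
  have h1 : WeakLim (U : Filter A) (fun u => bitranspose X e * κ (Y (u * b)))
      (bitranspose X e * κ (Y b)) :=
    (WeakLim.inclusion ((Y.continuous.tendsto b).comp (hr b))).const_mul _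
  have h2 : WeakLim (U : Filter A) (fun u => κ (X (u * b)) * bitranspose Y e)
      (κ (X b) * bitranspose Y e) :=
    (WeakLim.inclusion ((X.continuous.tendsto b).comp (hr b))).mul_const _
  simp only [bitranspose_mul_inclusion_mul he hr h] at h1
  simp only [inclusion_mul_bitranspose_mul he hl h] at h2
  exact h1.unique h2

/-- The extension of a map to the unitization, with the value of the bitranspose at the unit. -/
def unitExtension (e : Bidual A) (X : A →L[ℂ] B) : Unitization ℂ A →ₗ[ℂ] Bidual B where
  toFun x := x.fst • bitranspose X e + κ (X x.snd)
  map_add' x y := by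
    simp only [Unitization.fst_add, Unitization.snd_add, map_add]
    module
  map_smul' c x := by
    simp only [Unitization.fst_smul, Unitization.snd_smul, map_smul, RingHom.id_apply, smul_eq_mul]
    module

theorem unitExtension_apply (e : Bidual A) (X : A →L[ℂ] B) (x : Unitization ℂ A) :
    unitExtension e X x = x.fst • bitranspose X e + κ (X x.snd) := rfl

theorem unitExtension_one (e : Bidual A) (X : A →L[ℂ] B) :
    unitExtension e X 1 = bitranspose X e := by
  simp [unitExtension_apply]

theorem unitExtension_inr (e : Bidual A) (X : A →L[ℂ] B) (a : A) :
    unitExtension e X (a : Unitization ℂ A) = κ (X a) := by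
  simp [unitExtension_apply]

theorem unitExtension_mul (he : WeakLim (U : Filter A) (fun a => κ a) e)
    (hr : ∀ a, Tendsto (fun u => u * a) (U : Filter A) (𝓝 a))
    (hl : ∀ a, Tendsto (fun u => a * u) (U : Filter A) (𝓝 a)) {X Y : A →L[ℂ] B}
    (h : ∀ a b, a * b = 0 → X a * Y b = 0) (a b : Unitization ℂ A) :
    unitExtension e X a * unitExtension e Y b =
      unitExtension e X 1 * unitExtension e Y (a * b) := by
  have hb : ∀ a b c, X (a * c) * Y b = X a * Y (c * b) :=
    balanced_of_map_zero_product ((ContinuousLinearMap.mul ℂ B).bilinearComp X Y) h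
  have h1 := bitranspose_mul_inclusion_mul he hr hb a.snd b.snd
  have h2 := bitranspose_mul_inclusion he hr hl hb a.snd
  rw [inclusion_mul] at h1
  rw [unitExtension_one]
  simp only [unitExtension_apply, Unitization.fst_mul, Unitization.snd_mul, map_add, map_smul,
    mul_add, add_mul, smul_mul_assoc, mul_smul_comm, h1, h2]
  module

theorem star_unitExtension (he : WeakLim (U : Filter A) (fun a => κ a) e) (hu : star e = e)
    (φ : A →L[ℂ] B) (x : Unitization ℂ A) :
    star (unitExtension e φ x) = unitExtension e (adjointMap φ) (star x) := by
  rw [unitExtension_apply, unitExtension_apply, ← star_bitranspose he hu, adjointMap_apply]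
  ext f
  simp [bidual_star_apply, dualStar_apply]

theorem balancedPair_unitExtension (he : WeakLim (U : Filter A) (fun a => κ a) e)
    (hr : ∀ a, Tendsto (fun u => u * a) (U : Filter A) (𝓝 a))
    (hl : ∀ a, Tendsto (fun u => a * u) (U : Filter A) (𝓝 a)) (hu : star e = e) {φ : A →L[ℂ] B}
    (hrange : PreservesRangeOrthogonality φ) (hdomain : PreservesDomainOrthogonality φ)
    (hzero : PreservesZeroProducts φ) {D : Type*} [CStarAlgebra D] {Φ : Bidual B →ₗ[ℂ] D}
    (hmul : ∀ F G, Φ (F * G) = Φ F * Φ G) (hstar : ∀ F, Φ (star F) = star (Φ F)) :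
    BalancedPair (Φ ∘ₗ unitExtension e φ) (Φ ∘ₗ unitExtension e (adjointMap φ)) := by
  have key : ∀ {X Y : A →L[ℂ] B}, (∀ a b, a * b = 0 → X a * Y b = 0) →
      ∀ a b : Unitization ℂ A, Φ (unitExtension e X a) * Φ (unitExtension e Y b) =
        Φ (unitExtension e X 1) * Φ (unitExtension e Y (a * b)) := fun h a b => by
    rw [← hmul, ← hmul, unitExtension_mul he hr hl h]
  refine ⟨fun x => ?_, key hzero, key fun a b hab => ?_, key fun a b hab => ?_,
    key fun a b hab => ?_⟩
  · rw [LinearMap.comp_apply, LinearMap.comp_apply, ← hstar, star_unitExtension he hu]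
  · exact hdomain a (star b) (by rwa [star_star])
  · exact hrange (star a) b (by rwa [star_star])
  · rw [adjointMap_apply, adjointMap_apply, ← star_mul,
      hzero _ _ (by rw [← star_mul, hab, star_zero]), star_zero]

end Extension

/-! ### Uniqueness and the weight identities -/

section SupportHom

variable {A : Type u} {B : Type v} [NonUnitalCStarAlgebra A] [NonUnitalCStarAlgebra B]

/-- Taking adjoints, `z*` is annihilated on the left by every `φ b` and `(φ b)*`, so the support
condition on `p` applies to it. Differences `z` of candidate values of `π` are of this kind. -/
theorem mul_star_eq_zero_of_annihilates {φ : A →L[ℂ] B} {p : Bidual B}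
    (hp : ∀ x : Bidual B, (∀ b : A, κ (φ b) * x = 0 ∧ κ (star (φ b)) * x = 0) → p * x = 0)
    {z : Bidual B} (h : ∀ b, z * κ (φ b) = 0) (h' : ∀ b, z * κ (star (φ b)) = 0) :
    p * star z = 0 := by
  have h0 : star (0 : Bidual B) = 0 := by ext f; simp [bidual_star_apply]
  refine hp _ fun b => ⟨?_, ?_⟩
  · rw [← bidual_star_star (κ (φ b)), ← bidual_star_mul, ← inclusion_star, h', h0]
  · rw [inclusion_star, ← bidual_star_mul, h, h0]

theorem IsSupportHom.unique {φ : A →L[ℂ] B} {π π' : A →⋆ₙₐ[ℂ] Bidual B} (h : IsSupportHom φ π)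
    (h' : IsSupportHom φ π') : π' = π := by
  ext1 a
  rw [← sub_eq_zero]
  have h1 : ∀ b, (π' a - π a) * κ (φ b) = 0 := fun b => by
    rw [sub_mul, h.mul_map, h'.mul_map, sub_self]
  have h2 : ∀ b, (π' a - π a) * κ (star (φ b)) = 0 := fun b => by
    rw [sub_mul, h.mul_star_map, h'.mul_star_map, sub_self]
  apply eq_zero_of_mul_star_self
  rw [sub_mul, mul_star_eq_zero_of_annihilates (h.mul_eq_zero a) h1 h2,
    mul_star_eq_zero_of_annihilates (h'.mul_eq_zero a) h1 h2, sub_self]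

/-- Let `b` run through the approximate unit in the two product identities of `π`; the second, at
`a*`, is then starred. -/
theorem IsSupportHom.isWeightedBy {φ : A →L[ℂ] B} {π : A →⋆ₙₐ[ℂ] Bidual B}
    (h : IsSupportHom φ π) {U : Ultrafilter A} {e : Bidual A}
    (he : WeakLim (U : Filter A) (fun a => κ a) e)
    (hr : ∀ a, Tendsto (fun u => u * a) (U : Filter A) (𝓝 a))
    (hl : ∀ a, Tendsto (fun u => a * u) (U : Filter A) (𝓝 a)) :
    IsWeightedBy φ (bitranspose φ e) π := by
  intro a
  have hlim := weakLim_bitranspose he φ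
  constructor
  · have h1 := (hlim.star.const_mul (π (star a))).star
    simp only [← inclusion_star, h.mul_star_map, star_star] at h1
    rw [bidual_star_mul, bidual_star_star, map_star, bidual_star_star] at h1
    exact (WeakLim.inclusion ((φ.continuous.tendsto a).comp (hr a))).unique h1
  · have h1 := hlim.const_mul (π a)
    simp only [h.mul_map] at h1
    exact (WeakLim.inclusion ((φ.continuous.tendsto a).comp (hl a))).unique h1

end SupportHom

/-! ### Existence of the support ⋆-homomorphism -/

section Existence

variable {A : Type u} {B : Type v} [NonUnitalCStarAlgebra A] [NonUnitalCStarAlgebra B]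

/-- The embedding is not known to be isometric, but it controls each functional separately, and
uniform boundedness does the rest. -/
theorem exists_norm_le_of_embedding {D : Type*} [NormedAddCommGroup D] [Module ℂ D]
    {Φ : Bidual B →ₗ[ℂ] D} (hΦ : ∀ f, ∃ C : ℝ, ∀ F, ‖F f‖ ≤ C * ‖Φ F‖) {ι : Type*}
    {F : ι → Bidual B} {K : ℝ} (hF : ∀ i, ‖Φ (F i)‖ ≤ K) : ∃ C, ∀ i, ‖F i‖ ≤ C := by
  refine banach_steinhaus fun f => ?_
  obtain ⟨C, hC⟩ := hΦ f
  refine ⟨|C| * K, fun i => (hC (F i)).trans ?_⟩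
  calc C * ‖Φ (F i)‖ ≤ |C| * ‖Φ (F i)‖ := by gcongr; exact le_abs_self C
    _ ≤ |C| * K := by gcongr; exact hF i

/-- A map preserving range-orthogonality, domain-orthogonality and zero-products has a support
⋆-homomorphism. -/
theorem exists_isSupportHom {U : Ultrafilter A} {e : Bidual A} (hu : star e = e)
    (he : WeakLim (U : Filter A) (fun a => κ a) e)
    (hr : ∀ a, Tendsto (fun u => u * a) (U : Filter A) (𝓝 a))
    (hl : ∀ a, Tendsto (fun u => a * u) (U : Filter A) (𝓝 a)) {φ : A →L[ℂ] B}
    (hrange : PreservesRangeOrthogonality φ) (hdomain : PreservesDomainOrthogonality φ)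
    (hzero : PreservesZeroProducts φ) : ∃ π : A →⋆ₙₐ[ℂ] Bidual B, IsSupportHom φ π := by
  obtain ⟨D, _, Φ, hmul, hstar, hΦ⟩ := exists_bidual_embedding.{v, v} B
  have hP := balancedPair_unitExtension he hr hl hu hrange hdomain hzero hmul hstar
  set P := Φ ∘ₗ unitExtension e φ with hPdef
  set Q := Φ ∘ₗ unitExtension e (adjointMap φ) with hQdef
  have hPinr : ∀ a : A, P a = Φ (κ (φ a)) := fun a => by
    rw [hPdef, LinearMap.comp_apply, unitExtension_inr]
  have hQinr : ∀ a : A, Q a = Φ (κ (adjointMap φ a)) := fun a => by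
    rw [hQdef, LinearMap.comp_apply, unitExtension_inr]
  obtain ⟨t, ht⟩ := hP.exists_divSeq_tendsto
  let h := bitranspose φ e
  let h' := bitranspose (adjointMap φ) e
  let T : A → Bidual B := fun a => κ (φ a) * h' + κ (adjointMap φ a) * h
  let k := h * h' + h' * h
  let S : A → ℕ → Bidual B := fun a n => divSeq (t : ℂ) k (T a) n
  have hT : ∀ a : A, Φ (T a) = pairMap P Q a := fun a => by
    rw [pairMap_apply, hPinr, hQinr, map_add, hmul, hmul]
    simp only [hPdef, hQdef, LinearMap.comp_apply, unitExtension_one, h, h']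
  have hk : Φ k = pairMap P Q 1 := by
    rw [pairMap_apply, map_add, hmul, hmul]
    simp only [hPdef, hQdef, LinearMap.comp_apply, unitExtension_one, h, h']
  have hS : ∀ a n, Φ (S a n) = divSeq (t : ℂ) (pairMap P Q 1) (pairMap P Q a) n := fun a n => by
    rw [map_divSeq Φ hmul, hT, hk]
  let V : Ultrafilter ℕ := Ultrafilter.of atTop
  have hV : (V : Filter ℕ) ≤ atTop := Ultrafilter.of_le _
  have hlim : ∀ a, ∃ F, WeakLim (V : Filter ℕ) (S a) F := by
    intro a
    obtain ⟨C, hC⟩ := exists_norm_le_of_embedding hΦ (F := S a) (K := ‖(a : Unitization ℂ A)‖)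
      fun n => by
        rw [hS]
        exact (ht a).1 n
    exact WeakLim.exists_of_eventually_bounded V (S a) C (Eventually.of_forall hC)
  choose π hπ using hlim
  have hmap : ∀ a b, π a * κ (φ b) = κ (φ (a * b)) := by
    refine fun a b => ((hπ a).mul_const _).unique (WeakLim.of_embedding hΦ ?_)
    simpa only [hmul, hS, ← hPinr, Unitization.inr_mul] using ((ht a).2.1 b).mono_left hV
  have hmap' : ∀ a b, π a * κ (adjointMap φ b) = κ (adjointMap φ (a * b)) := by
    refine fun a b => ((hπ a).mul_const _).unique (WeakLim.of_embedding hΦ ?_)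
    simpa only [hmul, hS, ← hQinr, Unitization.inr_mul] using ((ht a).2.2 b).mono_left hV
  have hmap_star : ∀ a b, π a * κ (star (φ b)) = κ (star (φ (b * star a))) := by
    intro a b
    have := hmap' a (star b)
    simpa only [adjointMap_apply, star_mul, star_star] using this
  have hann : ∀ (a : A) (x : Bidual B),
      (∀ b : A, κ (φ b) * x = 0 ∧ κ (star (φ b)) * x = 0) → π a * x = 0 := by
    intro a x hx
    have hx' : ∀ b, κ (adjointMap φ b) * x = 0 := fun b => (hx (star b)).2
    have h1 : h * x = 0 := by
      refine ((weakLim_bitranspose he φ).mul_const x).unique ?_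
      simpa only [(hx _).1] using WeakLim.const 0
    have h2 : h' * x = 0 := by
      refine ((weakLim_bitranspose he (adjointMap φ)).mul_const x).unique ?_
      simpa only [hx'] using WeakLim.const 0
    have hkx : k * x = 0 := by simp only [k, add_mul, mul_assoc, h1, h2, mul_zero, add_zero]
    have hTx : T a * x = 0 := by simp only [T, add_mul, mul_assoc, h1, h2, mul_zero, add_zero]
    refine ((hπ a).mul_const x).unique ?_
    simpa only [S, divSeq_mul_eq_zero _ hkx hTx] using WeakLim.const 0
  have hadd : ∀ a b, π (a + b) = π a + π b := by
    refine fun a b => (hπ (a + b)).unique ?_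
    have hTadd : T (a + b) = T a + T b := by
      simp only [T, map_add, add_mul]
      abel
    simpa only [S, hTadd, divSeq_add] using (hπ a).add (hπ b)
  have hsmul : ∀ (c : ℂ) a, π (c • a) = c • π a := by
    refine fun c a => (hπ (c • a)).unique ?_
    have hTsmul : T (c • a) = c • T a := by
      simp only [T, map_smul, smul_mul_assoc, smul_add]
    simpa only [S, hTsmul, divSeq_smul] using (hπ a).const_smul c
  have hstar' : ∀ a, π (star a) = star (π a) := by
    refine fun a => (hπ (star a)).unique ?_
    have hSstar : ∀ n, star (S a n) = S (star a) n := fun n => eq_of_embedding_eq hΦ (by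
      rw [hstar, hS, hS, hP.star_divSeq, Unitization.inr_star])
    simpa only [hSstar] using (hπ a).star
  have hmul' : ∀ a b, π (a * b) = π a * π b := by
    intro a b
    rw [eq_comm, ← sub_eq_zero]
    -- Both `π a * π b` and `π (a * b)` act on `φ d` and `(φ d)*` in the same way, by associativity
    -- in `A`.
    have hz : ∀ c, π c * star (π a * π b - π (a * b)) = 0 := fun c =>
      mul_star_eq_zero_of_annihilates (hann c)
        (fun d => by rw [sub_mul, mul_assoc, hmap, hmap, hmap, mul_assoc, sub_self])
        (fun d => by
          rw [sub_mul, mul_assoc, hmap_star, hmap_star, hmap_star, star_mul, mul_assoc, sub_self])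
    apply eq_zero_of_mul_star_self
    rw [sub_mul, mul_assoc, hz, hz, mul_zero, sub_zero]
  have hzero' : π 0 = 0 := by simpa using hsmul 0 0
  let ρ : A →⋆ₙₐ[ℂ] Bidual B :=
    { toFun := π
      map_smul' := hsmul
      map_zero' := hzero'
      map_add' := hadd
      map_mul' := hmul'
      map_star' := hstar' }
  exact ⟨ρ, hmap, hmap_star, hann⟩

/-- Write the weight on the outer side of each factor, so that the two values of `π` meet in the
middle and multiply to zero. -/
theorem IsWeightedStarHom.preserves {φ : A →L[ℂ] B} (h : IsWeightedStarHom.{u, v, w} φ) :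
    PreservesRangeOrthogonality φ ∧ PreservesDomainOrthogonality φ ∧ PreservesZeroProducts φ := by
  obtain ⟨D, _, i, π, d, hi, hφ⟩ := h
  refine ⟨fun a b hab => hi ?_, fun a b hab => hi ?_, fun a b hab => hi ?_⟩
  · rw [map_mul, map_star, (hφ a).2, (hφ b).2, star_mul, ← map_star, mul_assoc,
      ← mul_assoc (π (star a)), ← map_mul, hab, map_zero, zero_mul, mul_zero, map_zero]
  · rw [map_mul, map_star, (hφ a).1, (hφ b).1, star_mul, ← map_star, mul_assoc,
      ← mul_assoc (π a), ← map_mul, hab, map_zero, zero_mul, mul_zero, map_zero]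
  · rw [map_mul, (hφ a).1, (hφ b).2, mul_assoc, ← mul_assoc (π a), ← map_mul, hab, map_zero,
      zero_mul, mul_zero, map_zero]

theorem IsWeightedBy.isWeightedStarHom {φ : A →L[ℂ] B} {H : Bidual B} {π : A →⋆ₙₐ[ℂ] Bidual B}
    (h : IsWeightedBy φ H π) : IsWeightedStarHom.{u, v, w} φ := by
  obtain ⟨D, _, Φ, hmul, hstar, hΦ⟩ := exists_bidual_embedding.{v, w} B
  let i : B →⋆ₙₐ[ℂ] D :=
    { toFun := fun b => Φ (κ b)
      map_smul' := fun c b => by simp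
      map_zero' := by simp
      map_add' := fun a b => by simp
      map_mul' := fun a b => by rw [inclusion_mul, hmul]
      map_star' := fun b => by rw [inclusion_star, hstar] }
  let ρ : A →⋆ₙₐ[ℂ] D :=
    { toFun := fun a => Φ (π a)
      map_smul' := fun c b => by simp
      map_zero' := by simp
      map_add' := fun a b => by simp
      map_mul' := fun a b => by rw [map_mul, hmul]
      map_star' := fun b => by rw [map_star, hstar] }
  refine ⟨D, inferInstance, i, ρ, Φ H, fun a b hab =>
    inclusion_injective (eq_of_embedding_eq hΦ hab), fun a => ⟨?_, ?_⟩⟩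
  · change Φ (κ (φ a)) = Φ H * Φ (π a)
    rw [(h a).1, hmul]
  · change Φ (κ (φ a)) = Φ (π a) * Φ H
    rw [(h a).2, hmul]

end Existence

end CStarBidual

end

open CStarBidual in
theorem theorem4p2 {A : Type u} {B : Type v} [NonUnitalCStarAlgebra A] [NonUnitalCStarAlgebra B]
    (φ : A →L[ℂ] B) :
    ∃ e : Bidual A, IsUnitElement e ∧
      List.TFAE [
        IsWeightedStarHom.{u, v, w} φ,
        ∃ π : A →⋆ₙₐ[ℂ] Bidual B, IsWeightedBy φ (bitranspose φ e) π,
        PreservesRangeOrthogonality φ ∧ PreservesDomainOrthogonality φ ∧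
          PreservesZeroProducts φ] ∧
      (PreservesRangeOrthogonality φ ∧ PreservesDomainOrthogonality φ ∧
          PreservesZeroProducts φ →
        ∃ π : A →⋆ₙₐ[ℂ] Bidual B, IsSupportHom φ π ∧ IsWeightedBy φ (bitranspose φ e) π ∧
          ∀ π' : A →⋆ₙₐ[ℂ] Bidual B, IsSupportHom φ π' → π' = π) := by
  obtain ⟨U, e, hunit, hu, he, hr, hl⟩ := exists_unitElement (A := A)
  have hsupport : PreservesRangeOrthogonality φ ∧ PreservesDomainOrthogonality φ ∧
      PreservesZeroProducts φ →
        ∃ π : A →⋆ₙₐ[ℂ] Bidual B, IsSupportHom φ π ∧ IsWeightedBy φ (bitranspose φ e) π ∧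
          ∀ π' : A →⋆ₙₐ[ℂ] Bidual B, IsSupportHom φ π' → π' = π := by
    rintro ⟨hrange, hdomain, hzero⟩
    obtain ⟨π, hπ⟩ := exists_isSupportHom hu he hr hl hrange hdomain hzero
    exact ⟨π, hπ, hπ.isWeightedBy he hr hl, fun π' hπ' => hπ.unique hπ'⟩
  refine ⟨e, hunit, ?_, hsupport⟩
  tfae_have 1 → 3 := IsWeightedStarHom.preserves
  tfae_have 2 → 1 := fun ⟨π, hπ⟩ => hπ.isWeightedStarHom
  tfae_have 3 → 2 := fun h => by
    obtain ⟨π, -, hπ, -⟩ := hsupport h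
    exact ⟨π, hπ⟩
  tfae_finish
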